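/- Let $\Gamma=\mathrm{SL}_2(\mathbb Z)$, $\Gamma_\infty=\{\pm\begin{pmatrix}1&n\\0&1\end{pmatrix}: n\in\mathbb Z\}$ and $j(\gamma,z)=cz+d$ for $\gamma=\begin{pmatrix}a&b\\c&d\end{pmatrix}$. For $k\in 2\mathbb Z$ and $z=x+iy$ with $y>0$ set $$E_k(z,s)=\sum_{\gamma\in\Gamma_\infty\backslash\Gamma}\left(\frac{j(\gamma,z)}{|j(\gamma,z)|}\right)^{-k}\operatorname{Im}(\gamma z)^s\qquad(\operatorname{Re}(s)>1),$$ $$\theta(s)=\pi^{-s}\Gamma(s)\zeta(2s),\qquad \theta_k(s)=\theta(s)\cdot s(s+1)\cdots(s+|k|/2-1),$$ and $E^*_k(z,s)=\theta_k(s)E_k(z,s)$ for $\operatorname{Re}(s)>1$. For each $z$ the function $s\mapsto E^*_k(z,s)$ has a meromorphic continuation to $\mathbb C$, also denoted $E^*_k(z,s)$, and $$E^*_k(z,s)=\theta_k(s)y^s+\theta_k(1-s)y^{1-s}+R_k(z,s),$$ where $R_k(z,s)$ is entire in $s$ and, for all $s\in\mathbb C$ with $\operatorname{Re}(s)=\sigma$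 and all $z=x+iy$ with $y>0$, $$R_k(z,s)=O\left(\left(y^{|k|/2+1/2}+y^{-|\sigma-1/2|-|k|/2-3/2}\right)e^{-2\pi y}\right),$$ with an implied constant that depends only on $k$ and $\sigma$. Here $\theta_k(s)y^s+\theta_k(1-s)y^{1-s}$ is understood as a meromorphic function of $s$ with its removable singularities filled in, and the displayed equality holds for all $s\in\mathbb C$, except that for $k=0$ the points $s=0,1$, where $\theta_0(s)y^s+\theta_0(1-s)y^{1-s}$ has poles, are excluded. -/

import Mathlib

open scoped UpperHalfPlane MatrixGroups

noncomputable section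

namespace WeightEisenstein

/-- The subgroup `Γ_∞ = {± (1 n; 0 1) : n ∈ ℤ}` of `SL(2, ℤ)`, here cut out by the vanishing of the
lower left entry; see `mem_gammaInf_iff`. -/
def gammaInf : Subgroup SL(2, ℤ) where
  carrier := {g | g 1 0 = 0}
  one_mem' := by simp
  mul_mem' := by
    intro a b ha hb
    simp only [Set.mem_ofPred_eq] at ha hb ⊢
    simp [Matrix.SpecialLinearGroup.coe_mul, Matrix.mul_apply, Fin.sum_univ_two, ha, hb]
  inv_mem' := by
    intro a ha
    simp only [Set.mem_ofPred_eq] at ha ⊢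
    simp [Matrix.SpecialLinearGroup.SL2_inv_expl, ha]

theorem mem_gammaInf_iff (g : SL(2, ℤ)) :
    g ∈ gammaInf ↔ ∃ n : ℤ, (g : Matrix (Fin 2) (Fin 2) ℤ) = !![1, n; 0, 1] ∨
      (g : Matrix (Fin 2) (Fin 2) ℤ) = -!![1, n; 0, 1] := by
  constructor
  · intro hg
    have hc : g 1 0 = 0 := hg
    have hd := g.det_coe
    rw [Matrix.det_fin_two, hc] at hd
    have hd' : g 0 0 * g 1 1 = 1 := by linarith
    rcases Int.eq_one_or_neg_one_of_mul_eq_one' hd' with ⟨h0, h1⟩ | ⟨h0, h1⟩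
    · refine ⟨g 0 1, Or.inl ?_⟩
      ext i j
      fin_cases i <;> fin_cases j <;> simp [h0, h1, hc]
    · refine ⟨-g 0 1, Or.inr ?_⟩
      ext i j
      fin_cases i <;> fin_cases j <;> simp [h0, h1, hc]
  · rintro ⟨n, h | h⟩
    · change g 1 0 = 0
      rw [h]; simp
    · change g 1 0 = 0
      rw [h]; simp

/-- The set of cosets `Γ_∞ \ Γ` for `Γ = SL(2, ℤ)`: `g` and `g'` are identified when
`g' = h * g` with `h ∈ Γ_∞`. -/
abbrev Cosets : Type := Quotient (QuotientGroup.rightRel gammaInf)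

/-- The automorphy factor `j(g, z) = c z + d`. -/
def autj (g : SL(2, ℤ)) (z : ℍ) : ℂ := ((g 1 0 : ℤ) : ℂ) * (z : ℂ) + ((g 1 1 : ℤ) : ℂ)

/-- The summand `(j(g, z) / |j(g, z)|) ^ (-k) * Im(g z) ^ s`. -/
def summand (k : ℤ) (z : ℍ) (s : ℂ) (g : SL(2, ℤ)) : ℂ :=
  (autj g z / (‖autj g z‖ : ℂ)) ^ (-k) * (((g • z).im : ℝ) : ℂ) ^ s

/-- For even `k` the summand depends only on the coset `Γ_∞ g`. -/
theorem summand_mul_left {k : ℤ} (hk : Even k) (z : ℍ) (s : ℂ) {h : SL(2, ℤ)}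
    (hh : h ∈ gammaInf) (g : SL(2, ℤ)) : summand k z s (h * g) = summand k z s g := by
  have hc : h 1 0 = 0 := hh
  have hd := h.det_coe
  rw [Matrix.det_fin_two, hc] at hd
  have hd' : h 0 0 * h 1 1 = 1 := by linarith
  have him : (h • (g • z)).im = (g • z).im := by
    obtain ⟨n, hn⟩ := ModularGroup.exists_eq_T_zpow_of_c_eq_zero hc
    rw [hn, ModularGroup.im_T_zpow_smul]
  have hj : autj (h * g) z = ((h 1 1 : ℤ) : ℂ) * autj g z := by
    simp only [autj, Matrix.SpecialLinearGroup.coe_mul, Matrix.mul_apply, Fin.sum_univ_two, hc]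
    push_cast
    ring
  unfold summand
  rw [mul_smul, him, hj]
  congr 1
  rcases Int.eq_one_or_neg_one_of_mul_eq_one' hd' with ⟨_, h1⟩ | ⟨_, h1⟩
  · simp [h1]
  · rw [h1]
    simp only [Int.cast_neg, Int.cast_one, neg_mul, one_mul, norm_neg, neg_div]
    exact hk.neg.neg_zpow _

/-- The non-holomorphic Eisenstein series of weight `k` (`k` even), given for `Re s > 1` by
`E_k(z, s) = ∑_{g ∈ Γ_∞ \ Γ} (j(g, z) / |j(g, z)|) ^ (-k) * Im(g z) ^ s`. The summand is evaluated
at a representative of each coset; by `summand_mul_left` the choice does not matter. -/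
def eisenstein (k : ℤ) (z : ℍ) (s : ℂ) : ℂ := ∑' γ : Cosets, summand k z s γ.out

/-- `θ(s) = π ^ (-s) Γ(s) ζ(2 s)`. -/
def theta (s : ℂ) : ℂ := (Real.pi : ℂ) ^ (-s) * Complex.Gamma s * riemannZeta (2 * s)

/-- `θ_k(s) = θ(s) * s (s + 1) ⋯ (s + |k|/2 - 1)` for even `k`. The formula has its true value
except at the poles of `Γ(s)` and of `ζ(2 s)`; below it is only used as a meromorphic function
of `s`, or for `Re s > 1`. -/
def thetaK (k : ℤ) (s : ℂ) : ℂ := theta s * ∏ j ∈ Finset.range (k.natAbs / 2), (s + (j : ℂ))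

/-- `F` is the meromorphic continuation to the `s`-plane of `s ↦ θ_k(s) E_k(z, s)`, `Re s > 1`.
Normal form means: analytic except at genuine poles (no removable singularities), where the value
is set to `0` by convention. Such an `F` is unique. -/
def IsCompletedEisenstein (k : ℤ) (z : ℍ) (F : ℂ → ℂ) : Prop :=
  MeromorphicNFOn F Set.univ ∧ ∀ s : ℂ, 1 < s.re → F s = thetaK k s * eisenstein k z s

open Classical in
/-- The completed non-holomorphic Eisenstein series `E^*_k(z, s)`, for all complex `s`, by
meromorphic continuation. -/
def completedEisenstein (k : ℤ) (z : ℍ) : ℂ → ℂ :=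
  if h : ∃ F : ℂ → ℂ, IsCompletedEisenstein k z F then h.choose else 0

/-- The meromorphic function `s ↦ θ_k(s) y ^ s + θ_k(1 - s) y ^ (1 - s)`, with its removable
singularities (such as `s = 1/2`) filled in. -/
def constantTerm (k : ℤ) (y : ℝ) : ℂ → ℂ :=
  toMeromorphicNFOn
    (fun s : ℂ ↦ thetaK k s * (y : ℂ) ^ s + thetaK k (1 - s) * (y : ℂ) ^ (1 - s)) Set.univ

end WeightEisenstein

end

open scoped UpperHalfPlane MatrixGroups

noncomputable section

namespace WeightEisenstein

open Filter Topology MeasureTheory EisensteinSeries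
open scoped FourierTransform

/-! The proof computes the Fourier expansion of `E_k` for `Re s > 1`, and then observes that every
piece of it makes sense for all `s`. Put `κ = |k|/2` and `ε = ±1` according to the sign of `k`.
Multiplying by `ζ(2s)` turns the sum over cosets, that is over coprime rows `(c, d)` up to sign,
into half the sum over all nonzero rows (`zeta_mul_eisenstein`). The row `c = 0` gives `ζ(2s) y^s`.
For `c = m ≥ 1` the sum over `d` runs over integer translates of a rescaled copy of `f(v) = (v -
iε)^(2κ) (v² + 1)^(-(s+κ))`, and Poisson summation applies (`mul_tsum_latticeFun`).

To find the Fourier transform of `f`, write the power of `v² + 1` as a Gamma integral in `t` and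
integrate in `v` first. The Gaussian moment is a Hermite-type polynomial times a Gaussian, so
`Γ(s+κ) π^(-(s+κ))` times the transform is a Mellin transform with weight `exp(-π(t + ξ²/t))`
(`fourier_latticeFun_eq_mellin`). The factor `Γ(s+κ) π^(-s) ζ(2s)` is exactly `θ_k(s)`. For `ξ ≠ 0`
the Mellin integral is entire in `s` and of size about `e^(-2π|ξ|)`. For `ξ = 0` an integration by
parts that lowers `κ` evaluates it, and summing over `m` with the functional equation of zeta gives
`θ_k(1-s) y^(1-s)` (`hasSum_zeroTerm`).

The nonzero frequencies form `R_k`. Uniform bounds on the Bessel-type integrals show that it is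
entire. They also give the stated estimate: exponential decay is extracted for `y ≥ 1`, while for `y
≤ 1` a power of `y` suffices, because `e^(-2πy)` is bounded below there.

The constant term is meromorphic on the plane and its possible poles can be checked directly, so the
identity theorem carries the expansion from `Re s > 1` to all `s`
(`completedEisenstein_of_expansion`). -/

/-! ### The constant term: poles and removable singularities. -/

/-- Identity theorem for meromorphic functions: infinite order at one point propagates through the
connected plane. -/
theorem eventually_nhdsNE_eq_zero_of_isOpen {f : ℂ → ℂ}
    (hf : MeromorphicOn f Set.univ) {U : Set ℂ} (hU : IsOpen U) {a : ℂ} (ha : a ∈ U)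
    (h : ∀ s ∈ U, f s = 0) (x : ℂ) : ∀ᶠ s in 𝓝[≠] x, f s = 0 := by
  rw [← meromorphicOrderAt_eq_top_iff]
  by_contra hx
  have h1 := (hf.exists_meromorphicOrderAt_ne_top_iff_forall isConnected_univ).1
    ⟨⟨x, trivial⟩, hx⟩ ⟨a, trivial⟩
  apply h1
  rw [meromorphicOrderAt_eq_top_iff]
  exact eventually_nhdsWithin_of_eventually_nhds (Filter.mem_of_superset (hU.mem_nhds ha) h)

/-- `1/Gammaℝ` is entire and not identically zero, so its zeros are isolated. These are the poles of
`Gammaℝ`, where the default value is `0` and `theta` does not have its true value. -/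
theorem eventually_Gammaℝ_two_mul_ne_zero (x : ℂ) :
    ∀ᶠ s in 𝓝[≠] x, Complex.Gammaℝ (2 * s) ≠ 0 := by
  have hd : Differentiable ℂ (fun s : ℂ ↦ (Complex.Gammaℝ (2 * s))⁻¹) :=
    Complex.differentiable_Gammaℝ_inv.comp (differentiable_id.const_mul 2)
  have hm : MeromorphicOn (fun s : ℂ ↦ (Complex.Gammaℝ (2 * s))⁻¹) Set.univ :=
    fun s _ ↦ (hd.analyticAt s).meromorphicAt
  have h1 : meromorphicOrderAt (fun s : ℂ ↦ (Complex.Gammaℝ (2 * s))⁻¹) x ≠ ⊤ := by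
    refine (hm.exists_meromorphicOrderAt_ne_top_iff_forall isConnected_univ).1
      ⟨⟨1, trivial⟩, ?_⟩ ⟨x, trivial⟩
    intro h
    rw [meromorphicOrderAt_eq_top_iff] at h
    have h2 := (hd.continuous.continuousAt (x := 1)).eventually_ne
      (inv_ne_zero (Complex.Gammaℝ_ne_zero_of_re_pos (by simp)))
    obtain ⟨s, hs1, hs2⟩ := (h.and (eventually_nhdsWithin_of_eventually_nhds h2)).exists
    exact hs2 hs1
  filter_upwards [(meromorphicOrderAt_ne_top_iff_eventually_ne_zero (hm x trivial)).1 h1] with s hs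
  exact fun h ↦ hs (by simp [h])

theorem theta_eq {s : ℂ} (hs : s ≠ 0) (h : Complex.Gammaℝ (2 * s) ≠ 0) :
    theta s = completedRiemannZeta (2 * s) := by
  rw [theta, riemannZeta_def_of_ne_zero (by simpa using hs)]
  have : (Real.pi : ℂ) ^ (-s) * Complex.Gamma s = Complex.Gammaℝ (2 * s) := by
    rw [Complex.Gammaℝ_def]
    congr 2 <;> ring
  rw [this]
  field_simp

/-- The product `s (s + 1) ⋯ (s + |k|/2 - 1)`. -/
def risingProd (k : ℤ) (s : ℂ) : ℂ := ∏ j ∈ Finset.range (k.natAbs / 2), (s + (j : ℂ))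

theorem thetaK_eq {k : ℤ} {s : ℂ} (hs : s ≠ 0) (h : Complex.Gammaℝ (2 * s) ≠ 0) :
    thetaK k s = completedRiemannZeta (2 * s) * risingProd k s := by
  rw [thetaK, theta_eq hs h, risingProd]

/-- The constant term of the Fourier expansion, in terms of the completed zeta function. -/
def constantTermAux (k : ℤ) (y : ℝ) (s : ℂ) : ℂ :=
  completedRiemannZeta (2 * s) * risingProd k s * (y : ℂ) ^ s +
    completedRiemannZeta (2 * (1 - s)) * risingProd k (1 - s) * (y : ℂ) ^ (1 - s)

theorem differentiable_risingProd (k : ℤ) : Differentiable ℂ (risingProd k) := by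
  unfold risingProd
  fun_prop

theorem constantTermAux_one_sub (k : ℤ) (y : ℝ) (s : ℂ) :
    constantTermAux k y (1 - s) = constantTermAux k y s := by
  simp only [constantTermAux, sub_sub_cancel]
  ring

theorem differentiable_ofReal_cpow {y : ℝ} (hy : 0 < y) :
    Differentiable ℂ (fun s : ℂ ↦ (y : ℂ) ^ s) := fun s ↦
  (differentiableAt_id).const_cpow (Or.inl (by exact_mod_cast hy.ne'))

theorem differentiableAt_constantTermAux (k : ℤ) {y : ℝ} (hy : 0 < y) {s : ℂ} (h0 : s ≠ 0)
    (h1 : s ≠ 1) (h2 : s ≠ 1 / 2) : DifferentiableAt ℂ (constantTermAux k y) s := by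
  have h3 : DifferentiableAt ℂ completedRiemannZeta (2 * s) :=
    differentiableAt_completedZeta (by simpa using h0) (fun h ↦ h2 (by rw [← h]; ring))
  have h4 : DifferentiableAt ℂ completedRiemannZeta (2 * (1 - s)) :=
    differentiableAt_completedZeta (by simpa [sub_eq_zero] using h1.symm)
      (fun h ↦ h2 (by linear_combination (-1/2) * h))
  have h5 := differentiable_risingProd k
  have h6 := differentiable_ofReal_cpow hy
  unfold constantTermAux
  have e1 : DifferentiableAt ℂ (fun s ↦ completedRiemannZeta (2 * s)) s :=
    h3.comp s (by fun_prop : DifferentiableAt ℂ (fun s : ℂ ↦ 2 * s) s)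
  have e2 : DifferentiableAt ℂ (fun s ↦ completedRiemannZeta (2 * (1 - s))) s :=
    h4.comp s (by fun_prop : DifferentiableAt ℂ (fun s : ℂ ↦ 2 * (1 - s)) s)
  have e3 : DifferentiableAt ℂ (fun s ↦ risingProd k (1 - s)) s :=
    (h5 _).comp s (by fun_prop : DifferentiableAt ℂ (fun s : ℂ ↦ 1 - s) s)
  have e4 : DifferentiableAt ℂ (fun s : ℂ ↦ (y : ℂ) ^ (1 - s)) s :=
    (h6 _).comp s (by fun_prop : DifferentiableAt ℂ (fun s : ℂ ↦ 1 - s) s)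
  exact ((e1.mul (h5 s)).mul (h6 s)).add ((e2.mul e3).mul e4)

theorem meromorphicAt_completedRiemannZeta (s : ℂ) : MeromorphicAt completedRiemannZeta s := by
  have : completedRiemannZeta = fun s ↦ completedRiemannZeta₀ s - 1 / s - 1 / (1 - s) :=
    funext completedRiemannZeta_eq
  rw [this]
  have := (differentiable_completedZeta₀.analyticAt s).meromorphicAt
  fun_prop

theorem meromorphicAt_constantTermAux (k : ℤ) {y : ℝ} (hy : 0 < y) (s : ℂ) :
    MeromorphicAt (constantTermAux k y) s := by
  have e1 : MeromorphicAt (fun s ↦ completedRiemannZeta (2 * s)) s :=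
    (meromorphicAt_completedRiemannZeta _).comp_analyticAt (g := fun s ↦ 2 * s) (by fun_prop)
  have e2 : MeromorphicAt (fun s ↦ completedRiemannZeta (2 * (1 - s))) s :=
    (meromorphicAt_completedRiemannZeta _).comp_analyticAt (g := fun s ↦ 2 * (1 - s)) (by fun_prop)
  have h5 := differentiable_risingProd k
  have h6 := differentiable_ofReal_cpow hy
  have e3 := (h5.comp (by fun_prop : Differentiable ℂ (fun s : ℂ ↦ 1 - s))).analyticAt s
  have e4 := (h6.comp (by fun_prop : Differentiable ℂ (fun s : ℂ ↦ 1 - s))).analyticAt s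
  exact ((e1.mul (h5.analyticAt s).meromorphicAt).mul (h6.analyticAt s).meromorphicAt).add
    ((e2.mul e3.meromorphicAt).mul e4.meromorphicAt)

theorem tendsto_mul_completedRiemannZeta_two_mul_half :
    Tendsto (fun s : ℂ ↦ (s - 1 / 2) * completedRiemannZeta (2 * s)) (𝓝[≠] (1 / 2)) (𝓝 (1 / 2)) := by
  have h : Tendsto (fun s : ℂ ↦ 2 * s) (𝓝[≠] (1 / 2)) (𝓝[≠] 1) := by
    refine tendsto_nhdsWithin_iff.2 ⟨?_, ?_⟩
    · have : ContinuousAt (fun s : ℂ ↦ 2 * s) (1 / 2) := by fun_prop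
      simpa [ContinuousAt] using this.tendsto.mono_left nhdsWithin_le_nhds
    · filter_upwards [self_mem_nhdsWithin] with s hs h
      exact hs (by simp only [Set.mem_singleton_iff] at h ⊢; rw [← h]; ring)
  have h2 := (completedRiemannZeta_residue_one.comp h).const_mul (1 / 2)
  simp only [mul_one] at h2
  refine h2.congr fun s ↦ ?_
  simp only [Function.comp_apply]
  ring

/-- The functional equation moves the residue at `1/2` to `0` through `s ↦ 1/2 - s`, with a change
of sign. -/
theorem tendsto_mul_completedRiemannZeta_two_mul_zero :
    Tendsto (fun s : ℂ ↦ s * completedRiemannZeta (2 * s)) (𝓝[≠] 0) (𝓝 (-1 / 2)) := by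
  have h : Tendsto (fun s : ℂ ↦ 1 / 2 - s) (𝓝[≠] 0) (𝓝[≠] (1 / 2)) := by
    refine tendsto_nhdsWithin_iff.2 ⟨?_, ?_⟩
    · have : ContinuousAt (fun s : ℂ ↦ 1 / 2 - s) 0 := by fun_prop
      simpa [ContinuousAt] using this.tendsto.mono_left nhdsWithin_le_nhds
    · filter_upwards [self_mem_nhdsWithin] with s hs h
      exact hs (by simpa using h)
  have h2 := (tendsto_mul_completedRiemannZeta_two_mul_half.comp h).neg
  rw [← neg_div] at h2
  refine h2.congr fun s ↦ ?_
  simp only [Function.comp_apply]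
  rw [show 2 * (1 / 2 - s) = 1 - 2 * s by ring, completedRiemannZeta_one_sub]
  ring

/-- The order at `a` is nonnegative as soon as multiplying by `s - a` gives limit zero. -/
theorem meromorphicOrderAt_nonneg_of_tendsto {f : ℂ → ℂ} {a : ℂ} (hf : MeromorphicAt f a)
    (h : Tendsto (fun s ↦ (s - a) * f s) (𝓝[≠] a) (𝓝 0)) : 0 ≤ meromorphicOrderAt f a := by
  have hlin : MeromorphicAt (fun s : ℂ ↦ s - a) a := by fun_prop
  have h1 : 0 < meromorphicOrderAt ((fun s : ℂ ↦ s - a) * f) a :=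
    (tendsto_zero_iff_meromorphicOrderAt_pos (hlin.mul hf)).1 h
  have h2 : meromorphicOrderAt (fun s : ℂ ↦ s - a) a = (1 : ℤ) := by
    rw [meromorphicOrderAt_eq_int_iff hlin]
    exact ⟨fun _ ↦ 1, analyticAt_const, one_ne_zero, by simp⟩
  rw [meromorphicOrderAt_mul hlin hf, h2] at h1
  cases h3 : meromorphicOrderAt f a with
  | top => simp
  | coe n =>
    rw [h3] at h1
    have : 0 < 1 + n := by exact_mod_cast h1
    exact_mod_cast (by lia : 0 ≤ n)

/-- Under `s ↦ 1 - s` the two halves of the constant term are exchanged while `s - 1/2` changes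
sign, so their residues at the fixed point `1/2` cancel. -/
theorem tendsto_mul_constantTermAux_half (k : ℤ) {y : ℝ} (hy : 0 < y) :
    Tendsto (fun s ↦ (s - 1 / 2) * constantTermAux k y s) (𝓝[≠] (1 / 2)) (𝓝 0) := by
  have h : Tendsto (fun s : ℂ ↦ 1 - s) (𝓝[≠] (1 / 2)) (𝓝[≠] (1 / 2)) := by
    refine tendsto_nhdsWithin_iff.2 ⟨?_, ?_⟩
    · have : ContinuousAt (fun s : ℂ ↦ 1 - s) (1 / 2) := by fun_prop
      have h2 := this.tendsto.mono_left (nhdsWithin_le_nhds (s := {1 / 2}ᶜ))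
      norm_num at h2
      norm_num
      exact h2
    · filter_upwards [self_mem_nhdsWithin] with s hs h
      exact hs (by
        simp only [Set.mem_singleton_iff] at h ⊢
        linear_combination -h)
  have h1 := tendsto_mul_completedRiemannZeta_two_mul_half
  have c1 : ContinuousAt (fun s ↦ risingProd k s * (y : ℂ) ^ s) (1 / 2) :=
    ((differentiable_risingProd k).mul (differentiable_ofReal_cpow hy)).continuous.continuousAt
  have h2 := h1.mul (c1.tendsto.mono_left (nhdsWithin_le_nhds (s := {1 / 2}ᶜ)))
  have h3 := h2.sub (h2.comp h)
  rw [sub_self] at h3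
  refine h3.congr fun s ↦ ?_
  simp only [Function.comp_apply, constantTermAux]
  ring

theorem risingProd_zero {k : ℤ} (hk : Even k) (h0 : k ≠ 0) : risingProd k 0 = 0 := by
  have : 0 < k.natAbs / 2 := by
    obtain ⟨m, rfl⟩ := hk
    lia
  exact Finset.prod_eq_zero (Finset.mem_range.2 this) (by simp)

/-- For `k ≠ 0` the rising product contains the factor `s`, which kills the simple pole of the first
half. The second half involves the completed zeta function near `2`, where it is regular. -/
theorem tendsto_mul_constantTermAux_zero {k : ℤ} (hk : Even k) (h0 : k ≠ 0) {y : ℝ} (hy : 0 < y) :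
    Tendsto (fun s ↦ (s - 0) * constantTermAux k y s) (𝓝[≠] 0) (𝓝 0) := by
  have c1 : ContinuousAt (fun s ↦ risingProd k s * (y : ℂ) ^ s) 0 :=
    ((differentiable_risingProd k).mul (differentiable_ofReal_cpow hy)).continuous.continuousAt
  have h1 := tendsto_mul_completedRiemannZeta_two_mul_zero.mul
    (c1.tendsto.mono_left (nhdsWithin_le_nhds (s := {0}ᶜ)))
  have c2 : ContinuousAt (fun s ↦ s * (completedRiemannZeta (2 * (1 - s)) * (risingProd k (1 - s) *
      (y : ℂ) ^ (1 - s)))) 0 := by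
    have e1 : ContinuousAt (fun s : ℂ ↦ 1 - s) 0 := by fun_prop
    have e2 : ContinuousAt completedRiemannZeta (2 * (1 - 0)) :=
      (differentiableAt_completedZeta (by simp) (by norm_num)).continuousAt
    have e3 : ContinuousAt (fun s ↦ completedRiemannZeta (2 * (1 - s))) 0 :=
      ContinuousAt.comp (f := fun s : ℂ ↦ 2 * (1 - s)) e2 (by fun_prop)
    have e4 : Continuous (fun s ↦ risingProd k s * (y : ℂ) ^ s) :=
      ((differentiable_risingProd k).mul (differentiable_ofReal_cpow hy)).continuous
    have e5 : Continuous (fun s ↦ risingProd k (1 - s) * (y : ℂ) ^ (1 - s)) :=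
      e4.comp (by fun_prop : Continuous (fun s : ℂ ↦ 1 - s))
    exact continuousAt_id.mul (e3.mul e5.continuousAt)
  have h2 := h1.add (c2.tendsto.mono_left (nhdsWithin_le_nhds (s := {0}ᶜ)))
  rw [risingProd_zero hk h0] at h2
  simp only [zero_mul, mul_zero, add_zero] at h2
  refine h2.congr fun s ↦ ?_
  simp only [constantTermAux]
  ring

theorem meromorphicOrderAt_constantTermAux_nonneg {k : ℤ} (hk : Even k) {y : ℝ} (hy : 0 < y)
    {s : ℂ} (h : k = 0 → s ≠ 0 ∧ s ≠ 1) : 0 ≤ meromorphicOrderAt (constantTermAux k y) s := by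
  have hm := meromorphicAt_constantTermAux k hy s
  by_cases h2 : s = 1 / 2
  · subst h2
    exact meromorphicOrderAt_nonneg_of_tendsto hm (tendsto_mul_constantTermAux_half k hy)
  by_cases h0 : s = 0
  · subst h0
    exact meromorphicOrderAt_nonneg_of_tendsto hm
      (tendsto_mul_constantTermAux_zero hk (fun hk0 ↦ (h hk0).1 rfl) hy)
  by_cases h1 : s = 1
  · subst h1
    refine meromorphicOrderAt_nonneg_of_tendsto hm ?_
    -- The point `1` is reduced to `0` by the symmetry `s ↦ 1 - s`.
    have ht : Tendsto (fun s : ℂ ↦ 1 - s) (𝓝[≠] 1) (𝓝[≠] 0) := by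
      refine tendsto_nhdsWithin_iff.2 ⟨?_, ?_⟩
      · have : ContinuousAt (fun s : ℂ ↦ 1 - s) 1 := by fun_prop
        simpa [ContinuousAt] using this.tendsto.mono_left nhdsWithin_le_nhds
      · filter_upwards [self_mem_nhdsWithin] with s hs h
        exact hs (by
          have h' : 1 - s = 0 := h
          exact (sub_eq_zero.1 h').symm)
    have h3 := ((tendsto_mul_constantTermAux_zero hk (fun hk0 ↦ (h hk0).2 rfl) hy).comp ht).neg
    rw [neg_zero] at h3
    refine h3.congr fun s ↦ ?_
    simp only [Function.comp_apply, constantTermAux_one_sub]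
    ring
  · have han : AnalyticAt ℂ (constantTermAux k y) s := by
      rw [Complex.analyticAt_iff_eventually_differentiableAt]
      filter_upwards [isOpen_ne.mem_nhds h0, isOpen_ne.mem_nhds h1, isOpen_ne.mem_nhds h2]
        with t ht0 ht1 ht2
      exact differentiableAt_constantTermAux k hy ht0 ht1 ht2
    exact han.meromorphicOrderAt_nonneg

theorem eventually_raw_eq_constantTermAux (k : ℤ) (y : ℝ) (x : ℂ) :
    (fun s : ℂ ↦ thetaK k s * (y : ℂ) ^ s + thetaK k (1 - s) * (y : ℂ) ^ (1 - s)) =ᶠ[𝓝[≠] x]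
      constantTermAux k y := by
  have ht : Tendsto (fun s : ℂ ↦ 1 - s) (𝓝[≠] x) (𝓝[≠] (1 - x)) := by
    refine tendsto_nhdsWithin_iff.2 ⟨?_, ?_⟩
    · have : ContinuousAt (fun s : ℂ ↦ 1 - s) x := by fun_prop
      exact this.tendsto.mono_left nhdsWithin_le_nhds
    · filter_upwards [self_mem_nhdsWithin] with s hs h
      exact hs (by simpa using h)
  have hne (x a : ℂ) : ∀ᶠ s in 𝓝[≠] x, s ≠ a := by
    by_cases hx : x = a
    · subst hx; exact self_mem_nhdsWithin
    · exact eventually_nhdsWithin_of_eventually_nhds (isOpen_ne.mem_nhds hx)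
  filter_upwards [eventually_Gammaℝ_two_mul_ne_zero x,
    ht.eventually (eventually_Gammaℝ_two_mul_ne_zero (1 - x)), hne x 0, hne x 1] with s h1 h2 h3 h4
  rw [thetaK_eq h3 h1, thetaK_eq (sub_ne_zero.2 h4.symm) h2, constantTermAux]

theorem constantTerm_spec (k : ℤ) {y : ℝ} (hy : 0 < y) :
    MeromorphicNFOn (constantTerm k y) Set.univ ∧
      ∀ x, constantTerm k y =ᶠ[𝓝[≠] x] constantTermAux k y := by
  refine ⟨meromorphicNFOn_toMeromorphicNFOn _ _, fun x ↦ ?_⟩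
  have hm : MeromorphicOn (fun s : ℂ ↦ thetaK k s * (y : ℂ) ^ s +
      thetaK k (1 - s) * (y : ℂ) ^ (1 - s)) Set.univ := fun s _ ↦
    (meromorphicAt_constantTermAux k hy s).congr (eventually_raw_eq_constantTermAux k y s).symm
  exact (hm.toMeromorphicNFOn_eq_self_on_nhdsNE (Set.mem_univ x)).trans
    (eventually_raw_eq_constantTermAux k y x)

theorem analyticAt_constantTerm {k : ℤ} (hk : Even k) {y : ℝ} (hy : 0 < y) {s : ℂ}
    (h : k = 0 → s ≠ 0 ∧ s ≠ 1) : AnalyticAt ℂ (constantTerm k y) s := by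
  obtain ⟨h1, h2⟩ := constantTerm_spec k hy
  rw [← (h1 (Set.mem_univ s)).meromorphicOrderAt_nonneg_iff_analyticAt,
    meromorphicOrderAt_congr (h2 s)]
  exact meromorphicOrderAt_constantTermAux_nonneg hk hy h

theorem constantTerm_eq_constantTermAux {k : ℤ} (hk : Even k) {y : ℝ} (hy : 0 < y) {s : ℂ}
    (hs : 1 < s.re) : constantTerm k y s = constantTermAux k y s := by
  have h0 : s ≠ 0 := by rintro rfl; norm_num at hs
  have h1 : s ≠ 1 := by rintro rfl; norm_num at hs
  have h2 : s ≠ 1 / 2 := by rintro rfl; norm_num at hs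
  have hc := (analyticAt_constantTerm hk hy (s := s) fun _ ↦ ⟨h0, h1⟩).continuousAt
  have hd := (differentiableAt_constantTermAux k hy h0 h1 h2).continuousAt
  exact ((hc.eventuallyEq_nhds_iff_eventuallyEq_nhdsNE hd).1 ((constantTerm_spec k hy).2 s)).eq_of_nhds

/-! ### Meromorphic continuation from an expansion on a half-plane. -/

/-- If `θ_k(s) E_k(z, s)` is the constant term plus an entire function for `Re s > 1`, then the
completed Eisenstein series exists and has that form everywhere. -/
theorem completedEisenstein_of_expansion {k : ℤ} (hk : Even k) (z : ℍ) {r : ℂ → ℂ}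
    (hr : Differentiable ℂ r)
    (h : ∀ s : ℂ, 1 < s.re →
      thetaK k s * eisenstein k z s = constantTermAux k z.im s + r s) :
    IsCompletedEisenstein k z (completedEisenstein k z) ∧
      ∀ s : ℂ, (k = 0 → s ≠ 0 ∧ s ≠ 1) →
        completedEisenstein k z s = constantTerm k z.im s + r s := by
  set C := constantTerm k z.im
  have hC : MeromorphicNFOn C Set.univ := (constantTerm_spec k z.im_pos).1
  have hm : MeromorphicOn (C + r) Set.univ := fun s hs ↦
    (hC hs).meromorphicAt.add (hr.analyticAt s).meromorphicAt
  have han (s : ℂ) (hs : k = 0 → s ≠ 0 ∧ s ≠ 1) : AnalyticAt ℂ (C + r) s :=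
    (analyticAt_constantTerm hk z.im_pos hs).add (hr.analyticAt s)
  have hright (s : ℂ) (hs : 1 < s.re) : k = 0 → s ≠ 0 ∧ s ≠ 1 := fun _ ↦
    ⟨by rintro rfl; norm_num at hs, by rintro rfl; norm_num at hs⟩
  have hex : ∃ F, IsCompletedEisenstein k z F := by
    refine ⟨toMeromorphicNFOn (C + r) Set.univ, meromorphicNFOn_toMeromorphicNFOn _ _, fun s hs ↦ ?_⟩
    rw [toMeromorphicNFOn_eq_toMeromorphicNFAt hm (Set.mem_univ s),
      toMeromorphicNFAt_eq_self.2 (han s (hright s hs)).meromorphicNFAt, h s hs, Pi.add_apply]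
    rw [show C s = _ from constantTerm_eq_constantTermAux hk z.im_pos hs]
  have hE : IsCompletedEisenstein k z (completedEisenstein k z) := by
    rw [completedEisenstein, dif_pos hex]
    exact hex.choose_spec
  refine ⟨hE, fun s hs ↦ ?_⟩
  have hmd : MeromorphicOn (completedEisenstein k z - (C + r)) Set.univ :=
    hE.1.meromorphicOn.sub hm
  have hz := eventually_nhdsNE_eq_zero_of_isOpen hmd
    (isOpen_lt continuous_const Complex.continuous_re : IsOpen {b : ℂ | 1 < b.re}) (a := 2)
    (by norm_num) (fun t ht ↦ by
      simp only [Pi.sub_apply, Pi.add_apply]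
      rw [hE.2 t ht, h t ht, show C t = _ from constantTerm_eq_constantTermAux hk z.im_pos ht, sub_self]) s
  have he : completedEisenstein k z =ᶠ[𝓝[≠] s] C + r := by
    filter_upwards [hz] with t ht
    exact sub_eq_zero.1 ht
  -- Agreement near `s` extends to `s` itself because both sides are in normal form there. This is
  -- where the poles for `k = 0` must be excluded.
  exact (((hE.1 (Set.mem_univ s)).eventuallyEq_nhdsNE_iff_eventuallyEq_nhds
    (han s hs).meromorphicNFAt).1 he).eq_of_nhds

/-! ### Hermite-type polynomials and Bessel-type integrals. -/

/-- The polynomials `H_p(v) = ∫ (u - i v)^p exp(-π u²) du`, given by their recursion. -/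
def hermiteI : ℕ → ℝ → ℂ
  | 0, _ => 1
  | 1, v => -Complex.I * v
  | p + 2, v => -Complex.I * v * hermiteI (p + 1) v + (p + 1) / (2 * Real.pi) * hermiteI p v

theorem continuous_hermiteI (p : ℕ) : Continuous (hermiteI p) := by
  induction p using Nat.twoStepInduction with
  | zero => simp only [hermiteI]; fun_prop
  | one => simp only [hermiteI]; fun_prop
  | more p h1 h2 => simp only [hermiteI]; fun_prop

theorem exists_norm_hermiteI_le (p : ℕ) :
    ∃ C : ℝ, 0 ≤ C ∧ ∀ v : ℝ, ‖hermiteI p v‖ ≤ C * (1 + |v|) ^ p := by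
  induction p using Nat.twoStepInduction with
  | zero => exact ⟨1, zero_le_one, fun v ↦ by simp [hermiteI]⟩
  | one => exact ⟨1, zero_le_one, fun v ↦ by simp [hermiteI]⟩
  | more p h1 h2 =>
    obtain ⟨C1, h1p, h1⟩ := h1
    obtain ⟨C2, h2p, h2⟩ := h2
    refine ⟨C2 + (p + 1) / (2 * Real.pi) * C1, by positivity, fun v ↦ ?_⟩
    have hv := abs_nonneg v
    have e1 : ‖-Complex.I * v * hermiteI (p + 1) v‖ ≤ C2 * (1 + |v|) ^ (p + 2) := by
      rw [norm_mul, norm_mul, norm_neg, Complex.norm_I, one_mul, Complex.norm_real,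
        Real.norm_eq_abs]
      calc |v| * ‖hermiteI (p + 1) v‖ ≤ (1 + |v|) * (C2 * (1 + |v|) ^ (p + 1)) := by
            gcongr
            · linarith
            · exact h2 v
        _ = _ := by ring
    have e2 : ‖((p : ℂ) + 1) / (2 * Real.pi) * hermiteI p v‖ ≤
        (p + 1) / (2 * Real.pi) * C1 * (1 + |v|) ^ (p + 2) := by
      have e3 : ‖((p : ℂ) + 1) / (2 * Real.pi)‖ = (p + 1) / (2 * Real.pi) := by
        have : ((p : ℂ) + 1) / (2 * Real.pi) = (((p + 1) / (2 * Real.pi) : ℝ) : ℂ) := by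
          push_cast; ring
        rw [this, Complex.norm_real, Real.norm_eq_abs, abs_of_nonneg (by positivity)]
      rw [norm_mul, e3, mul_assoc]
      gcongr
      refine (h1 v).trans ?_
      gcongr
      · linarith
      · lia
    calc ‖hermiteI (p + 2) v‖ ≤ _ := norm_add_le _ _
      _ ≤ _ := add_le_add e1 e2
      _ = _ := by ring

theorem exists_norm_hermiteI_two_mul_le (κ : ℕ) :
    ∃ C : ℝ, 0 ≤ C ∧ ∀ v : ℝ, ‖hermiteI (2 * κ) v‖ ≤ C * (1 + v ^ 2) ^ κ := by
  obtain ⟨C, hC, h⟩ := exists_norm_hermiteI_le (2 * κ)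
  refine ⟨C * 2 ^ κ, by positivity, fun v ↦ (h v).trans ?_⟩
  rw [pow_mul, mul_assoc, ← mul_pow]
  gcongr
  nlinarith [sq_nonneg (1 - |v|), sq_abs v]

/-- Integrand of the Bessel type integrals in the Fourier coefficients. -/
def besselKernel (κ : ℕ) (a b X τ : ℝ) : ℂ :=
  hermiteI (2 * κ) (√X * (a * √τ + b / √τ)) * (Real.exp (-(Real.pi * (X * (τ + 1 / τ)))) : ℝ)

/-- `∫ τ ^ (s - 3 / 2) H_{2κ}(√X (a √τ + b / √τ)) exp(-π X (τ + 1 / τ)) dτ`. -/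
def besselIntegral (κ : ℕ) (a b X : ℝ) (s : ℂ) : ℂ := mellin (besselKernel κ a b X) (s - 1 / 2)

/-- With `x = 1 + 2W`, `x^n ≤ n! e^x` grows at most like `e^(2W)`, and `π ≥ 2` lets `e^(-πW)` absorb
it. The power `n` leaves room for `W^D`. -/
theorem exists_pow_mul_exp_le_rpow (κ : ℕ) (D : ℝ) (hD : 0 ≤ D) :
    ∃ C : ℝ, 0 ≤ C ∧ ∀ W : ℝ, 0 < W →
      (1 + 2 * W) ^ κ * Real.exp (-(Real.pi * W)) ≤ C * W ^ (-D) := by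
  set n := κ + ⌈D⌉₊
  refine ⟨n.factorial * Real.exp 1, by positivity, fun W hW ↦ ?_⟩
  have h1 : (1 + 2 * W) ^ n ≤ n.factorial * Real.exp (1 + 2 * W) := by
    have := Real.pow_div_factorial_le_exp (1 + 2 * W) (by positivity) n
    rwa [div_le_iff₀' (by positivity)] at this
  have h2 : W ^ D ≤ (1 + 2 * W) ^ ⌈D⌉₊ := by
    rw [← Real.rpow_natCast]
    calc W ^ D ≤ (1 + 2 * W) ^ D := Real.rpow_le_rpow hW.le (by linarith) hD
      _ ≤ _ := Real.rpow_le_rpow_of_exponent_le (by linarith) (Nat.le_ceil D)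
  rw [Real.rpow_neg hW.le, ← div_eq_mul_inv, le_div_iff₀ (by positivity)]
  calc (1 + 2 * W) ^ κ * Real.exp (-(Real.pi * W)) * W ^ D
      ≤ (1 + 2 * W) ^ κ * Real.exp (-(Real.pi * W)) * (1 + 2 * W) ^ ⌈D⌉₊ := by gcongr
    _ = (1 + 2 * W) ^ n * Real.exp (-(Real.pi * W)) := by rw [pow_add]; ring
    _ ≤ n.factorial * Real.exp (1 + 2 * W) * Real.exp (-(2 * W)) := by
        gcongr
        exact Real.two_le_pi
    _ = _ := by rw [mul_assoc, ← Real.exp_add]; ring_nf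

theorem sq_arg_le {a b X τ : ℝ} (ha : a ^ 2 = 1) (hb : b ^ 2 = 1) (hX : 0 < X) (hτ : 0 < τ) :
    (√X * (a * √τ + b / √τ)) ^ 2 ≤ 2 * (X * (τ + 1 / τ)) := by
  have h0 : √τ ≠ 0 := by positivity
  have h1 : (a * √τ) ^ 2 = τ := by rw [mul_pow, ha, Real.sq_sqrt hτ.le, one_mul]
  have h2 : (b / √τ) ^ 2 = 1 / τ := by rw [div_pow, hb, Real.sq_sqrt hτ.le]
  rw [mul_pow, Real.sq_sqrt hX.le]
  have : (a * √τ + b / √τ) ^ 2 ≤ 2 * (τ + 1 / τ) := by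
    nlinarith [sq_nonneg (a * √τ - b / √τ)]
  nlinarith

theorem two_le_add_one_div {τ : ℝ} (hτ : 0 < τ) : 2 ≤ τ + 1 / τ := by
  have : τ + 1 / τ - 2 = (τ - 1) ^ 2 / τ := by field_simp; ring
  have h : 0 ≤ (τ - 1) ^ 2 / τ := by positivity
  linarith

theorem exists_norm_besselKernel_le (κ : ℕ) :
    ∃ C : ℝ, 0 ≤ C ∧ ∀ a b X τ : ℝ, a ^ 2 = 1 → b ^ 2 = 1 → 0 < X → 0 < τ →
      ‖besselKernel κ a b X τ‖ ≤ C * ((1 + 2 * (X * (τ + 1 / τ))) ^ κ *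
        Real.exp (-(Real.pi * (X * (τ + 1 / τ))))) := by
  obtain ⟨C, hC, h⟩ := exists_norm_hermiteI_two_mul_le κ
  refine ⟨C, hC, fun a b X τ ha hb hX hτ ↦ ?_⟩
  rw [besselKernel, norm_mul, Complex.norm_real, Real.norm_eq_abs, Real.abs_exp]
  rw [← mul_assoc C]
  refine mul_le_mul_of_nonneg_right ((h _).trans ?_) (Real.exp_nonneg _)
  gcongr
  exact sq_arg_le ha hb hX hτ

theorem exists_norm_besselKernel_le_rpow (κ : ℕ) {D : ℝ} (hD : 0 ≤ D) :
    ∃ C : ℝ, 0 ≤ C ∧ ∀ a b X τ : ℝ, a ^ 2 = 1 → b ^ 2 = 1 → 0 < X → 0 < τ →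
      ‖besselKernel κ a b X τ‖ ≤ C * X ^ (-D) * (τ + 1 / τ) ^ (-D) := by
  obtain ⟨C1, hC1, h1⟩ := exists_norm_besselKernel_le κ
  obtain ⟨C2, hC2, h2⟩ := exists_pow_mul_exp_le_rpow κ D hD
  refine ⟨C1 * C2, by positivity, fun a b X τ ha hb hX hτ ↦ (h1 a b X τ ha hb hX hτ).trans ?_⟩
  rw [mul_assoc, mul_assoc, ← Real.mul_rpow hX.le (by positivity)]
  exact mul_le_mul_of_nonneg_left (h2 (X * (τ + 1 / τ)) (by positivity)) hC1

/-- Write `w = τ + 1/τ ≥ 2`. Expanding `(X - 1)(w - 2) ≥ 0` gives `Xw ≥ 2X + w - 2`, which splits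
off `e^(-2πX)` and keeps `e^(-πw)` for convergence in `τ`. -/
theorem exists_norm_besselKernel_le_exp (κ : ℕ) {D : ℝ} (hD : 0 ≤ D) :
    ∃ C : ℝ, 0 ≤ C ∧ ∀ a b X τ : ℝ, a ^ 2 = 1 → b ^ 2 = 1 → 1 ≤ X → 0 < τ →
      ‖besselKernel κ a b X τ‖ ≤
        C * (X ^ κ * Real.exp (-(2 * Real.pi * X))) * (τ + 1 / τ) ^ (-D) := by
  obtain ⟨C1, hC1, h1⟩ := exists_norm_besselKernel_le κ
  obtain ⟨C2, hC2, h2⟩ := exists_pow_mul_exp_le_rpow κ D hD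
  refine ⟨C1 * Real.exp (2 * Real.pi) * C2, by positivity, fun a b X τ ha hb hX hτ ↦
    (h1 a b X τ ha hb (by linarith) hτ).trans ?_⟩
  set w := τ + 1 / τ
  have hw : 2 ≤ w := two_le_add_one_div hτ
  have e1 : (1 + 2 * (X * w)) ^ κ ≤ X ^ κ * (1 + 2 * w) ^ κ := by
    rw [← mul_pow]
    gcongr
    nlinarith
  have e2 : Real.exp (-(Real.pi * (X * w))) ≤
      Real.exp (-(2 * Real.pi * X)) * Real.exp (2 * Real.pi) * Real.exp (-(Real.pi * w)) := by
    rw [← Real.exp_add, ← Real.exp_add]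
    apply Real.exp_le_exp.2
    nlinarith [mul_nonneg Real.pi_pos.le (mul_nonneg (sub_nonneg.2 hX) (sub_nonneg.2 hw))]
  have e3 := h2 w (by linarith)
  calc C1 * ((1 + 2 * (X * w)) ^ κ * Real.exp (-(Real.pi * (X * w))))
      ≤ C1 * ((X ^ κ * (1 + 2 * w) ^ κ) * (Real.exp (-(2 * Real.pi * X)) *
        Real.exp (2 * Real.pi) * Real.exp (-(Real.pi * w)))) := by gcongr
    _ = C1 * Real.exp (2 * Real.pi) * (X ^ κ * Real.exp (-(2 * Real.pi * X))) *
        ((1 + 2 * w) ^ κ * Real.exp (-(Real.pi * w))) := by ring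
    _ ≤ C1 * Real.exp (2 * Real.pi) * (X ^ κ * Real.exp (-(2 * Real.pi * X))) *
        (C2 * w ^ (-D)) := by gcongr
    _ = _ := by ring

/-- Since `τ + 1/τ` dominates both `τ` and `1/τ`, the exponent `B + 2` tames `τ^(b-1)` at both ends.
The majorant is the same for the whole strip `|b| ≤ B`. -/
theorem rpow_mul_add_one_div_rpow_le {b B τ : ℝ} (hb : |b| ≤ B) (hτ : 0 < τ) :
    τ ^ (b - 1) * (τ + 1 / τ) ^ (-(B + 2)) ≤ 2 * (1 + τ ^ 2)⁻¹ := by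
  have hB : 0 ≤ B := (abs_nonneg b).trans hb
  obtain ⟨hb1, hb2⟩ := abs_le.1 hb
  rcases le_total 1 τ with h | h
  · have e1 : (τ + 1 / τ) ^ (-(B + 2)) ≤ τ ^ (-(B + 2)) :=
      Real.rpow_le_rpow_of_nonpos hτ (by simp [hτ.le]) (by linarith)
    calc τ ^ (b - 1) * (τ + 1 / τ) ^ (-(B + 2)) ≤ τ ^ (b - 1) * τ ^ (-(B + 2)) := by gcongr
      _ = τ ^ (b - 1 + -(B + 2)) := (Real.rpow_add hτ _ _).symm
      _ ≤ τ ^ (-2 : ℝ) := Real.rpow_le_rpow_of_exponent_le h (by linarith)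
      _ = (τ ^ 2)⁻¹ := by rw [Real.rpow_neg hτ.le]; norm_cast
      _ ≤ _ := by
        rw [← div_eq_mul_inv, inv_eq_one_div, div_le_div_iff₀ (by positivity) (by positivity)]
        nlinarith
  · have e1 : (τ + 1 / τ) ^ (-(B + 2)) ≤ (1 / τ) ^ (-(B + 2)) :=
      Real.rpow_le_rpow_of_nonpos (by positivity) (by linarith) (by linarith)
    have e2 : (1 / τ) ^ (-(B + 2)) = τ ^ (B + 2) := by
      rw [one_div, Real.inv_rpow hτ.le, Real.rpow_neg hτ.le, inv_inv]
    calc τ ^ (b - 1) * (τ + 1 / τ) ^ (-(B + 2)) ≤ τ ^ (b - 1) * τ ^ (B + 2) := by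
          rw [← e2]; gcongr
      _ = τ ^ (b - 1 + (B + 2)) := (Real.rpow_add hτ _ _).symm
      _ ≤ 1 := Real.rpow_le_one hτ.le h (by linarith)
      _ ≤ _ := by
        rw [← div_eq_mul_inv, le_div_iff₀ (by positivity)]
        nlinarith

theorem norm_besselIntegral_le_of_kernel {κ : ℕ} {a b X B M : ℝ} {s : ℂ} (hM : 0 ≤ M)
    (hs : |s.re - 1 / 2| ≤ B)
    (h : ∀ τ : ℝ, 0 < τ → ‖besselKernel κ a b X τ‖ ≤ M * (τ + 1 / τ) ^ (-(B + 2))) :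
    ‖besselIntegral κ a b X s‖ ≤ 2 * Real.pi * M := by
  have hi : Integrable (fun τ : ℝ ↦ 2 * M * (1 + τ ^ 2)⁻¹) := integrable_inv_one_add_sq.const_mul _
  calc ‖besselIntegral κ a b X s‖ ≤ ∫ τ in Set.Ioi (0 : ℝ), 2 * M * (1 + τ ^ 2)⁻¹ := by
        refine norm_integral_le_of_norm_le hi.integrableOn ?_
        filter_upwards [ae_restrict_mem measurableSet_Ioi] with τ hτ
        rw [norm_smul, Complex.norm_cpow_eq_rpow_re_of_pos hτ]
        have e : (s - 1 / 2 - 1 : ℂ).re = s.re - 1 / 2 - 1 := by simp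
        rw [e]
        calc τ ^ (s.re - 1 / 2 - 1) * ‖besselKernel κ a b X τ‖
            ≤ τ ^ (s.re - 1 / 2 - 1) * (M * (τ + 1 / τ) ^ (-(B + 2))) := by
              exact mul_le_mul_of_nonneg_left (h τ hτ) (Real.rpow_nonneg (le_of_lt hτ) _)
          _ = M * (τ ^ (s.re - 1 / 2 - 1) * (τ + 1 / τ) ^ (-(B + 2))) := by ring
          _ ≤ M * (2 * (1 + τ ^ 2)⁻¹) := by
              exact mul_le_mul_of_nonneg_left (rpow_mul_add_one_div_rpow_le hs hτ) hM
          _ = _ := by ring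
    _ ≤ ∫ τ : ℝ, 2 * M * (1 + τ ^ 2)⁻¹ :=
        setIntegral_le_integral hi (Eventually.of_forall fun τ ↦ by positivity)
    _ = _ := by rw [integral_const_mul, integral_univ_inv_one_add_sq]; ring

theorem exists_norm_besselIntegral_le_rpow (κ : ℕ) {B : ℝ} (hB : 0 ≤ B) :
    ∃ C : ℝ, 0 ≤ C ∧ ∀ (a b X : ℝ) (s : ℂ), a ^ 2 = 1 → b ^ 2 = 1 → 0 < X →
      |s.re - 1 / 2| ≤ B → ‖besselIntegral κ a b X s‖ ≤ C * X ^ (-(B + 2)) := by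
  obtain ⟨C, hC, h⟩ := exists_norm_besselKernel_le_rpow κ (D := B + 2) (by linarith)
  refine ⟨2 * Real.pi * C, by positivity, fun a b X s ha hb hX hs ↦ ?_⟩
  rw [mul_assoc]
  exact norm_besselIntegral_le_of_kernel (by positivity) hs fun τ hτ ↦ h a b X τ ha hb hX hτ

theorem exists_norm_besselIntegral_le_exp (κ : ℕ) {B : ℝ} (hB : 0 ≤ B) :
    ∃ C : ℝ, 0 ≤ C ∧ ∀ (a b X : ℝ) (s : ℂ), a ^ 2 = 1 → b ^ 2 = 1 → 1 ≤ X →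
      |s.re - 1 / 2| ≤ B →
        ‖besselIntegral κ a b X s‖ ≤ C * (X ^ κ * Real.exp (-(2 * Real.pi * X))) := by
  obtain ⟨C, hC, h⟩ := exists_norm_besselKernel_le_exp κ (D := B + 2) (by linarith)
  refine ⟨2 * Real.pi * C, by positivity, fun a b X s ha hb hX hs ↦ ?_⟩
  rw [mul_assoc]
  have : 0 ≤ X := by linarith
  exact norm_besselIntegral_le_of_kernel (by positivity) hs fun τ hτ ↦ h a b X τ ha hb hX hτ

theorem continuousOn_besselKernel (κ : ℕ) (a b X : ℝ) :
    ContinuousOn (besselKernel κ a b X) (Set.Ioi 0) := by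
  unfold besselKernel
  have h1 : ContinuousOn (fun τ : ℝ ↦ √X * (a * √τ + b / √τ)) (Set.Ioi 0) := by
    refine continuousOn_const.mul ((by fun_prop : ContinuousOn (fun τ : ℝ ↦ a * √τ) _).add
      (continuousOn_const.div (by fun_prop) fun τ hτ ↦ ?_))
    exact (Real.sqrt_pos.2 hτ).ne'
  have h2 : ContinuousOn (fun τ : ℝ ↦ τ + 1 / τ) (Set.Ioi 0) :=
    continuousOn_id.add (continuousOn_const.div continuousOn_id fun τ hτ ↦ (ne_of_gt hτ))
  refine ((continuous_hermiteI _).comp_continuousOn h1).mul ?_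
  exact Complex.continuous_ofReal.comp_continuousOn (Real.continuous_exp.comp_continuousOn
    (continuousOn_const.mul (continuousOn_const.mul h2)).neg)

theorem differentiable_besselIntegral (κ : ℕ) {a b X : ℝ} (ha : a ^ 2 = 1) (hb : b ^ 2 = 1)
    (hX : 0 < X) : Differentiable ℂ (besselIntegral κ a b X) := by
  intro s
  -- Decay of order `D` at infinity and at zero puts `s - 1/2` strictly inside the strip of
  -- convergence.
  set D := |(s - 1 / 2).re| + 1
  have hD : 0 ≤ D := by positivity
  obtain ⟨C, hC, h⟩ := exists_norm_besselKernel_le_rpow κ hD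
  have hm : DifferentiableAt ℂ (mellin (besselKernel κ a b X)) (s - 1 / 2) := by
    refine mellin_differentiableAt_of_isBigO_rpow (a := D) (b := -D)
      ((continuousOn_besselKernel κ a b X).locallyIntegrableOn measurableSet_Ioi) ?_ ?_ ?_ ?_
    · refine Asymptotics.IsBigO.of_bound (C * X ^ (-D)) ?_
      filter_upwards [eventually_gt_atTop 0] with τ hτ
      refine (h a b X τ ha hb hX hτ).trans ?_
      rw [Real.norm_eq_abs, abs_of_nonneg (by positivity)]
      gcongr ?_ * ?_
      exact Real.rpow_le_rpow_of_nonpos hτ (by simp [hτ.le]) (by linarith)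
    · exact (le_abs_self _).trans_lt (by simp [D])
    · refine Asymptotics.IsBigO.of_bound (C * X ^ (-D)) ?_
      filter_upwards [self_mem_nhdsWithin] with τ hτ
      have hτ' : 0 < τ := hτ
      refine (h a b X τ ha hb hX hτ).trans ?_
      rw [neg_neg, Real.norm_eq_abs, abs_of_nonneg (by positivity)]
      gcongr ?_ * ?_
      have e2 : (1 / τ) ^ (-D) = τ ^ D := by
        rw [one_div, Real.inv_rpow hτ'.le, Real.rpow_neg hτ'.le, inv_inv]
      rw [← e2]
      exact Real.rpow_le_rpow_of_nonpos (by positivity) (by linarith) (by linarith)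
    · have := neg_abs_le (s - 1 / 2).re
      simp only [D]
      linarith
  exact hm.comp s (by fun_prop : DifferentiableAt ℂ (fun s : ℂ ↦ s - 1 / 2) s)

/-! ### The Fourier series of the remainder: convergence, holomorphy and growth. -/

/-- The `(m, l)` term of the non-constant part of the Fourier expansion. -/
def fourierTerm (κ : ℕ) (ε : ℝ) (z : ℍ) (p : ℕ+ × ℤ) (s : ℂ) : ℂ :=
  if p.2 = 0 then 0 else
    (√z.im : ℂ) * ((|(p.2 : ℝ)| / (p.1 : ℝ) : ℝ) : ℂ) ^ (s - 1 / 2) *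
      besselIntegral κ ε (SignType.sign (p.2 : ℝ)) (|(p.2 : ℝ)| * ((p.1 : ℝ) * z.im)) s *
      Complex.exp (2 * Real.pi * Complex.I * (p.2 * (p.1 * z.re)))

/-- The non-constant part of the Fourier expansion. -/
def fourierRemainder (κ : ℕ) (ε : ℝ) (z : ℍ) (s : ℂ) : ℂ :=
  (Real.pi : ℂ) ^ κ * ∑' p : ℕ+ × ℤ, fourierTerm κ ε z p s

/-- A summable majorant for the Fourier terms. -/
def fourierWeight (p : ℕ+ × ℤ) : ℝ := ((p.1 : ℝ) ^ 2)⁻¹ * ((p.2 : ℝ) ^ 2)⁻¹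

theorem fourierWeight_nonneg (p : ℕ+ × ℤ) : 0 ≤ fourierWeight p := by
  unfold fourierWeight; positivity

theorem summable_fourierWeight : Summable fourierWeight := by
  have h1 : Summable (fun m : ℕ+ ↦ ((m : ℝ) ^ 2)⁻¹) :=
    (Real.summable_nat_pow_inv.2 one_lt_two).comp_injective PNat.coe_injective
  have h2 : Summable (fun l : ℤ ↦ ((l : ℝ) ^ 2)⁻¹) := by
    simpa using (Real.summable_one_div_int_pow (p := 2)).2 one_lt_two
  exact h1.mul_of_nonneg h2 (fun _ ↦ by positivity) (fun _ ↦ by positivity)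

theorem sign_sq_of_int_ne_zero {l : ℤ} (hl : l ≠ 0) :
    ((SignType.sign (l : ℝ) : SignType) : ℝ) ^ 2 = 1 := by
  rcases lt_or_gt_of_ne hl with h | h
  · have : (l : ℝ) < 0 := by exact_mod_cast h
    simp [sign_neg this]
  · have : 0 < (l : ℝ) := by exact_mod_cast h
    simp [sign_pos this]

theorem div_rpow_le_mul_rpow {a m b B : ℝ} (ha : 1 ≤ a) (hm : 1 ≤ m) (hb : |b| ≤ B) :
    (a / m) ^ b ≤ (a * m) ^ B := by
  have h1 : 1 ≤ a * m := by nlinarith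
  have hd : 0 < a / m := by positivity
  have h2 : (a / m) ^ b ≤ (a * m) ^ |b| := by
    rcases le_total 0 b with h | h
    · rw [abs_of_nonneg h]
      refine Real.rpow_le_rpow hd.le ?_ h
      rw [div_le_iff₀ (by positivity)]
      nlinarith [mul_le_mul hm hm zero_le_one (by linarith)]
    · rw [abs_of_nonpos h, ← inv_div, Real.inv_rpow (by positivity), ← Real.rpow_neg (by positivity)]
      refine Real.rpow_le_rpow (by positivity) ?_ (by linarith)
      rw [div_le_iff₀ (by positivity)]
      nlinarith [mul_le_mul ha ha zero_le_one (by linarith)]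
  exact h2.trans (Real.rpow_le_rpow_of_exponent_le h1 hb)

theorem norm_fourierTerm_le {κ : ℕ} {ε : ℝ} {z : ℍ} {p : ℕ+ × ℤ} {s : ℂ} {B M : ℝ}
    (hs : |s.re - 1 / 2| ≤ B) (hp : p.2 ≠ 0)
    (hM : ‖besselIntegral κ ε (SignType.sign (p.2 : ℝ)) (|(p.2 : ℝ)| * ((p.1 : ℝ) * z.im)) s‖ ≤ M) :
    ‖fourierTerm κ ε z p s‖ ≤ √z.im * (|(p.2 : ℝ)| * p.1) ^ B * M := by
  have hl : (1 : ℝ) ≤ |(p.2 : ℝ)| := by exact_mod_cast Int.one_le_abs hp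
  have hm : (1 : ℝ) ≤ p.1 := by exact_mod_cast (one_le : 1 ≤ p.1)
  have he : ‖Complex.exp (2 * Real.pi * Complex.I * (p.2 * (p.1 * z.re)))‖ = 1 := by
    have : (2 * Real.pi * Complex.I * (p.2 * (p.1 * z.re)) : ℂ) =
        ((2 * Real.pi * (p.2 * (p.1 * z.re)) : ℝ) : ℂ) * Complex.I := by
      push_cast; ring
    rw [this, Complex.norm_exp_ofReal_mul_I]
  rw [fourierTerm, if_neg hp, norm_mul, he, mul_one, norm_mul, norm_mul, Complex.norm_real,
    Real.norm_eq_abs, abs_of_nonneg (Real.sqrt_nonneg _),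
    Complex.norm_cpow_eq_rpow_re_of_pos (by positivity)]
  have e : (s - 1 / 2 : ℂ).re = s.re - 1 / 2 := by simp
  rw [e]
  gcongr
  exact div_rpow_le_mul_rpow hl hm hs

theorem mul_fourierWeight {p : ℕ+ × ℤ} (hp : p.2 ≠ 0) :
    (|(p.2 : ℝ)| * p.1) ^ (-2 : ℝ) = fourierWeight p := by
  rw [Real.rpow_neg (by positivity), fourierWeight]
  norm_cast
  push_cast
  rw [mul_pow, mul_inv, mul_comm, sq_abs]

/-- With `N = |l| m`, the integral is `O((Ny)^(-(B+2)))`. The factor `N^B` from `(|l|/m)^(s-1/2)`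
leaves the summable `N^(-2)`, and `√y` brings the exponent of `y` to `-B - 3/2`. -/
theorem exists_norm_fourierTerm_le_of_im (κ : ℕ) {ε : ℝ} (hε : ε ^ 2 = 1) {B : ℝ} (hB : 0 ≤ B) :
    ∃ C : ℝ, 0 ≤ C ∧ ∀ (z : ℍ) (p : ℕ+ × ℤ) (s : ℂ), |s.re - 1 / 2| ≤ B →
      ‖fourierTerm κ ε z p s‖ ≤ C * z.im ^ (-B - 3 / 2) * fourierWeight p := by
  obtain ⟨C, hC, h⟩ := exists_norm_besselIntegral_le_rpow κ hB
  refine ⟨C, hC, fun z p s hs ↦ ?_⟩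
  have hy := z.im_pos
  by_cases hp : p.2 = 0
  · rw [fourierTerm, if_pos hp, norm_zero]
    have := fourierWeight_nonneg p
    positivity
  have hl : (1 : ℝ) ≤ |(p.2 : ℝ)| := by exact_mod_cast Int.one_le_abs hp
  have hm : (1 : ℝ) ≤ p.1 := by exact_mod_cast (one_le : 1 ≤ p.1)
  set N := |(p.2 : ℝ)| * p.1 with hN
  have hNpos : 0 < N := by positivity
  have hX : |(p.2 : ℝ)| * ((p.1 : ℝ) * z.im) = N * z.im := by rw [hN]; ring
  refine (norm_fourierTerm_le hs hp (h ε _ _ s hε (sign_sq_of_int_ne_zero hp)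
    (by positivity) hs)).trans (le_of_eq ?_)
  rw [hX, Real.mul_rpow hNpos.le hy.le, ← mul_fourierWeight hp, ← hN, Real.sqrt_eq_rpow]
  have e1 : N ^ B * N ^ (-(B + 2)) = N ^ (-2 : ℝ) := by
    rw [← Real.rpow_add hNpos]; congr 1; ring
  have e2 : z.im ^ (1 / 2 : ℝ) * z.im ^ (-(B + 2)) = z.im ^ (-B - 3 / 2) := by
    rw [← Real.rpow_add hy]; congr 1; ring
  rw [← e1, ← e2]
  ring

theorem exists_norm_fourierTerm_le_exp (κ : ℕ) {ε : ℝ} (hε : ε ^ 2 = 1) {B : ℝ} (hB : 0 ≤ B) :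
    ∃ C : ℝ, 0 ≤ C ∧ ∀ (z : ℍ) (p : ℕ+ × ℤ) (s : ℂ), 1 ≤ z.im → |s.re - 1 / 2| ≤ B →
      ‖fourierTerm κ ε z p s‖ ≤
        C * (z.im ^ (κ + 1 / 2 : ℝ) * Real.exp (-2 * Real.pi * z.im)) * fourierWeight p := by
  obtain ⟨C1, hC1, h1⟩ := exists_norm_besselIntegral_le_exp κ hB
  obtain ⟨C2, hC2, h2⟩ := exists_pow_mul_exp_le_rpow 0 (B + κ + 2) (by positivity)
  refine ⟨C1 * (Real.exp (2 * Real.pi) * C2), by positivity, fun z p s hz hs ↦ ?_⟩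
  have hy := z.im_pos
  by_cases hp : p.2 = 0
  · rw [fourierTerm, if_pos hp, norm_zero]
    have := fourierWeight_nonneg p
    positivity
  have hl : (1 : ℝ) ≤ |(p.2 : ℝ)| := by exact_mod_cast Int.one_le_abs hp
  have hm : (1 : ℝ) ≤ p.1 := by exact_mod_cast (one_le : 1 ≤ p.1)
  set N := |(p.2 : ℝ)| * p.1 with hN
  have hN1 : 1 ≤ N := by nlinarith
  have hNpos : 0 < N := by positivity
  have hX : |(p.2 : ℝ)| * ((p.1 : ℝ) * z.im) = N * z.im := by rw [hN]; ring
  refine (norm_fourierTerm_le hs hp (h1 ε _ _ s hε (sign_sq_of_int_ne_zero hp)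
    (by rw [hX]; nlinarith) hs)).trans ?_
  rw [hX, ← mul_fourierWeight hp, ← hN, Real.sqrt_eq_rpow]
  -- From `(N - 1)(y - 1) ≥ 0` one has `Ny ≥ N + y - 1`. Half of the decay in `N` is kept, enough to
  -- absorb `N^(B+κ)` and leave `N^(-2)`.
  have e1 : Real.exp (-(2 * Real.pi * (N * z.im))) ≤ Real.exp (-2 * Real.pi * z.im) *
      (Real.exp (2 * Real.pi) * Real.exp (-(Real.pi * N))) := by
    rw [← Real.exp_add, ← Real.exp_add]
    apply Real.exp_le_exp.2
    nlinarith [mul_nonneg Real.pi_pos.le (mul_nonneg (sub_nonneg.2 hN1) (sub_nonneg.2 hz)),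
      mul_nonneg Real.pi_pos.le hNpos.le]
  have e2 : Real.exp (-(Real.pi * N)) ≤ C2 * N ^ (-(B + κ + 2)) := by simpa using h2 N hNpos
  have e3 : z.im ^ (κ + 1 / 2 : ℝ) = z.im ^ (1 / 2 : ℝ) * z.im ^ κ := by
    rw [← Real.rpow_natCast z.im κ, ← Real.rpow_add hy]; congr 1; ring
  have e4 : N ^ B * N ^ κ * N ^ (-(B + κ + 2)) = N ^ (-2 : ℝ) := by
    rw [← Real.rpow_natCast N κ, ← Real.rpow_add hNpos, ← Real.rpow_add hNpos]; congr 1; ring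
  calc z.im ^ (1 / 2 : ℝ) * N ^ B * (C1 * ((N * z.im) ^ κ *
        Real.exp (-(2 * Real.pi * (N * z.im)))))
      ≤ z.im ^ (1 / 2 : ℝ) * N ^ B * (C1 * ((N * z.im) ^ κ *
        (Real.exp (-2 * Real.pi * z.im) * (Real.exp (2 * Real.pi) *
          (C2 * N ^ (-(B + κ + 2))))))) := by
        gcongr
        refine e1.trans ?_
        gcongr
    _ = _ := by rw [e3, ← e4, mul_pow]; ring

theorem summable_fourierTerm (κ : ℕ) {ε : ℝ} (hε : ε ^ 2 = 1) (z : ℍ) (s : ℂ) :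
    Summable (fun p ↦ fourierTerm κ ε z p s) := by
  obtain ⟨C, hC, h⟩ := exists_norm_fourierTerm_le_of_im κ hε (abs_nonneg (s.re - 1 / 2))
  exact Summable.of_norm_bounded (summable_fourierWeight.mul_left _) fun p ↦ h z p s le_rfl

theorem differentiable_fourierTerm (κ : ℕ) {ε : ℝ} (hε : ε ^ 2 = 1) (z : ℍ) (p : ℕ+ × ℤ) :
    Differentiable ℂ (fourierTerm κ ε z p) := by
  unfold fourierTerm
  by_cases hp : p.2 = 0
  · simp [hp]
  have hl : (0 : ℝ) < |(p.2 : ℝ)| := abs_pos.2 (by exact_mod_cast hp)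
  have hm : (0 : ℝ) < p.1 := by exact_mod_cast p.1.pos
  have hy := z.im_pos
  simp only [hp, if_false]
  have h1 := differentiable_besselIntegral κ (X := |(p.2 : ℝ)| * ((p.1 : ℝ) * z.im)) hε
    (sign_sq_of_int_ne_zero hp) (by positivity)
  have h2 : Differentiable ℂ
      (fun s : ℂ ↦ ((|(p.2 : ℝ)| / (p.1 : ℝ) : ℝ) : ℂ) ^ (s - 1 / 2)) :=
    (differentiable_ofReal_cpow (by positivity)).comp (differentiable_id.sub_const _)
  exact ((h2.const_mul _).mul h1).mul_const _

theorem differentiable_fourierRemainder (κ : ℕ) {ε : ℝ} (hε : ε ^ 2 = 1) (z : ℍ) :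
    Differentiable ℂ (fourierRemainder κ ε z) := by
  refine Differentiable.const_mul (fun s ↦ ?_) _
  -- The extra `1` makes the strip an open neighbourhood of `s` on which one summable majorant
  -- serves.
  set B := |s.re - 1 / 2| + 1
  obtain ⟨C, hC, h⟩ := exists_norm_fourierTerm_le_of_im κ hε (B := B) (by positivity)
  have ho : IsOpen {t : ℂ | |t.re - 1 / 2| < B} :=
    isOpen_lt (by fun_prop) continuous_const
  have hd := Complex.differentiableOn_tsum_of_summable_norm
    (summable_fourierWeight.mul_left (C * z.im ^ (-B - 3 / 2)))
    (fun p ↦ (differentiable_fourierTerm κ hε z p).differentiableOn) ho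
    (fun p t ht ↦ h z p t (le_of_lt ht))
  exact (hd s (by simp [B])).differentiableAt (ho.mem_nhds (by simp [B]))

theorem exists_norm_fourierRemainder_le (κ : ℕ) {ε : ℝ} (hε : ε ^ 2 = 1) (σ : ℝ) :
    ∃ C : ℝ, ∀ (z : ℍ) (s : ℂ), s.re = σ →
      ‖fourierRemainder κ ε z s‖ ≤ C * ((z.im ^ (κ + 1 / 2 : ℝ) +
        z.im ^ (-|σ - 1 / 2| - κ - 3 / 2)) * Real.exp (-2 * Real.pi * z.im)) := by
  obtain ⟨C1, hC1, h1⟩ := exists_norm_fourierTerm_le_of_im κ hε (abs_nonneg (σ - 1 / 2))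
  obtain ⟨C2, hC2, h2⟩ := exists_norm_fourierTerm_le_exp κ hε (abs_nonneg (σ - 1 / 2))
  set S := ∑' p, fourierWeight p
  have hS : 0 ≤ S := tsum_nonneg fourierWeight_nonneg
  refine ⟨Real.pi ^ κ * S * (C1 * Real.exp (2 * Real.pi) + C2), fun z s hs ↦ ?_⟩
  have hy := z.im_pos
  have hπ : ‖(Real.pi : ℂ) ^ κ‖ = Real.pi ^ κ := by
    rw [norm_pow, Complex.norm_real, Real.norm_eq_abs, abs_of_pos Real.pi_pos]
  have key (M : ℝ) (hM : ∀ p, ‖fourierTerm κ ε z p s‖ ≤ M * fourierWeight p) :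
      ‖fourierRemainder κ ε z s‖ ≤ Real.pi ^ κ * (M * S) := by
    rw [fourierRemainder, norm_mul, hπ]
    gcongr
    exact tsum_of_norm_bounded (summable_fourierWeight.hasSum.mul_left M) hM
  rcases le_total 1 z.im with h | h
  · refine (key _ fun p ↦ h2 z p s h (by rw [hs])).trans ?_
    have e : 0 ≤ z.im ^ (-|σ - 1 / 2| - κ - 3 / 2) := by positivity
    calc Real.pi ^ κ * (C2 * (z.im ^ (κ + 1 / 2 : ℝ) * Real.exp (-2 * Real.pi * z.im)) * S)
        = Real.pi ^ κ * S * (0 + C2) * ((z.im ^ (κ + 1 / 2 : ℝ) + 0) *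
          Real.exp (-2 * Real.pi * z.im)) := by ring
      _ ≤ _ := by gcongr; positivity
  · refine (key _ fun p ↦ h1 z p s (by rw [hs])).trans ?_
    have e : 0 ≤ z.im ^ (κ + 1 / 2 : ℝ) := by positivity
    have e1 : z.im ^ (-|σ - 1 / 2| - 3 / 2) ≤ z.im ^ (-|σ - 1 / 2| - κ - 3 / 2) :=
      -- For `y ≤ 1` lowering the exponent by `κ` only weakens the bound, and `e^(2π) e^(-2πy) ≥ 1`
      -- inserts the exponential for free.
      Real.rpow_le_rpow_of_exponent_ge hy h (by linarith [(Nat.cast_nonneg κ : (0 : ℝ) ≤ κ)])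
    have e2 : 1 ≤ Real.exp (2 * Real.pi) * Real.exp (-2 * Real.pi * z.im) := by
      rw [← Real.exp_add]
      exact Real.one_le_exp (by nlinarith [Real.pi_pos])
    calc Real.pi ^ κ * (C1 * z.im ^ (-|σ - 1 / 2| - 3 / 2) * S)
        ≤ Real.pi ^ κ * (C1 * z.im ^ (-|σ - 1 / 2| - κ - 3 / 2) * S) *
          (Real.exp (2 * Real.pi) * Real.exp (-2 * Real.pi * z.im)) := by
          refine (le_mul_of_one_le_right (by positivity) e2).trans ?_
          gcongr
      _ = Real.pi ^ κ * S * (C1 * Real.exp (2 * Real.pi) + 0) *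
          ((0 + z.im ^ (-|σ - 1 / 2| - κ - 3 / 2)) * Real.exp (-2 * Real.pi * z.im)) := by ring
      _ ≤ _ := by gcongr

/-! ### Moments of Gaussians. -/

/-- `(u - i ε) ^ p exp(-π t u² - 2 π i ξ u)`. -/
def gaussianMoment (ε t ξ : ℝ) (p : ℕ) (u : ℝ) : ℂ :=
  ((u : ℂ) - Complex.I * ε) ^ p *
    Complex.exp (-(Real.pi * t * u ^ 2) - 2 * Real.pi * Complex.I * ξ * u)

theorem norm_gaussianMoment (ε t ξ : ℝ) (p : ℕ) (u : ℝ) :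
    ‖gaussianMoment ε t ξ p u‖ =
      ‖(u : ℂ) - Complex.I * ε‖ ^ p * Real.exp (-(Real.pi * t * u ^ 2)) := by
  rw [gaussianMoment, norm_mul, norm_pow, Complex.norm_exp]
  congr 2
  have : (-(Real.pi * t * u ^ 2) - 2 * Real.pi * Complex.I * ξ * u : ℂ) =
      ((-(Real.pi * t * u ^ 2) : ℝ) : ℂ) + ((-(2 * Real.pi * ξ * u) : ℝ) : ℂ) * Complex.I := by
    push_cast; ring
  rw [this]
  simp [-Complex.ofReal_neg, -Complex.ofReal_mul, -Complex.ofReal_pow]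

theorem continuous_gaussianMoment (ε t ξ : ℝ) (p : ℕ) : Continuous (gaussianMoment ε t ξ p) := by
  unfold gaussianMoment
  fun_prop

theorem integrable_gaussianMoment (ε : ℝ) {t : ℝ} (ht : 0 < t) (ξ : ℝ) (p : ℕ) :
    Integrable (gaussianMoment ε t ξ p) := by
  set a := Real.pi * t / 2 with ha
  have ha0 : 0 < a := by positivity
  have hi := (integrable_exp_neg_mul_sq ha0).const_mul
    (p.factorial * Real.exp (|ε| + 1 / (4 * a)))
  refine hi.mono' (continuous_gaussianMoment ε t ξ p).aestronglyMeasurable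
    (Eventually.of_forall fun u ↦ ?_)
  rw [norm_gaussianMoment]
  have h1 : ‖(u : ℂ) - Complex.I * ε‖ ≤ |u| + |ε| := by
    refine (norm_sub_le _ _).trans ?_
    simp
  have h2 : ‖(u : ℂ) - Complex.I * ε‖ ^ p ≤ p.factorial * Real.exp (|u| + |ε|) := by
    have := Real.pow_div_factorial_le_exp (|u| + |ε|) (by positivity) p
    rw [div_le_iff₀' (by positivity)] at this
    exact (pow_le_pow_left₀ (norm_nonneg _) h1 p).trans this
  -- Half of the Gaussian exponent, `a = πt/2`, pays for the factor `e^|u|` that bounds the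
  -- polynomial.
  have h3 : |u| ≤ 1 / (4 * a) + a * u ^ 2 := by
    have : 1 / (4 * a) + a * u ^ 2 - |u| = (2 * a * |u| - 1) ^ 2 / (4 * a) := by
      rw [← sq_abs u]; field_simp; ring
    have h : 0 ≤ (2 * a * |u| - 1) ^ 2 / (4 * a) := by positivity
    linarith
  calc _ ≤ p.factorial * Real.exp (|u| + |ε|) * Real.exp (-(Real.pi * t * u ^ 2)) := by gcongr
    _ = p.factorial * Real.exp (|u| + |ε| - Real.pi * t * u ^ 2) := by
        rw [mul_assoc, ← Real.exp_add]; ring_nf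
    _ ≤ p.factorial * Real.exp (|ε| + 1 / (4 * a) + -a * u ^ 2) := by
        gcongr
        have : Real.pi * t * u ^ 2 = 2 * (a * u ^ 2) := by rw [ha]; ring
        linarith
    _ = _ := by rw [mul_assoc, ← Real.exp_add]

/-- The integral of the derivative of a moment integrand vanishes. The exponential contributes
`-2πtu - 2πiξ = -2πt(u - iε) - 2πi(tε + ξ)`. At `p = 0` the truncated index `p - 1` is harmless, its
coefficient being `0`. -/
theorem integral_gaussianMoment_rec (ε : ℝ) {t : ℝ} (ht : 0 < t) (ξ : ℝ) (p : ℕ) :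
    (p : ℂ) * (∫ u, gaussianMoment ε t ξ (p - 1) u) -
      2 * Real.pi * t * (∫ u, gaussianMoment ε t ξ (p + 1) u) -
      2 * Real.pi * Complex.I * (t * ε + ξ) * (∫ u, gaussianMoment ε t ξ p u) = 0 := by
  have hi := integrable_gaussianMoment ε ht ξ
  have hi1 := (hi (p - 1)).const_mul (p : ℂ)
  have hi2 := (hi (p + 1)).const_mul (2 * Real.pi * t : ℂ)
  have hi3 := (hi p).const_mul (2 * Real.pi * Complex.I * (t * ε + ξ))
  have hd (u : ℝ) : HasDerivAt (gaussianMoment ε t ξ p)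
      ((p : ℂ) * gaussianMoment ε t ξ (p - 1) u -
      2 * Real.pi * t * gaussianMoment ε t ξ (p + 1) u -
      2 * Real.pi * Complex.I * (t * ε + ξ) * gaussianMoment ε t ξ p u) u := by
    have e0 : HasDerivAt (fun u : ℝ ↦ (u : ℂ)) 1 u := Complex.ofRealCLM.hasDerivAt
    have e1 := (e0.sub_const (Complex.I * ε)).pow p
    have e2 := (((e0.pow 2).const_mul (Real.pi * t : ℂ)).neg.sub
      (e0.const_mul (2 * Real.pi * Complex.I * ξ))).cexp
    refine (e1.mul e2).congr_deriv ?_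
    simp only [gaussianMoment, Pi.pow_apply, Pi.neg_apply, Pi.sub_apply]
    push_cast
    rw [pow_succ]
    simp only [pow_one, mul_one]
    ring
  have hi12 : Integrable (fun u ↦ (p : ℂ) * gaussianMoment ε t ξ (p - 1) u -
      2 * Real.pi * t * gaussianMoment ε t ξ (p + 1) u) := hi1.sub hi2
  rw [← integral_const_mul, ← integral_const_mul, ← integral_const_mul, ← integral_sub hi1 hi2,
    ← integral_sub hi12 hi3]
  exact integral_eq_zero_of_hasDerivAt_of_integrable hd ((hi1.sub hi2).sub hi3) (hi p)

theorem integral_gaussianMoment_zero (ε : ℝ) {t : ℝ} (ht : 0 < t) (ξ : ℝ) :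
    ∫ u, gaussianMoment ε t ξ 0 u = (√t : ℂ)⁻¹ * Complex.exp (-(Real.pi * ξ ^ 2 / t)) := by
  have h := fourierIntegral_gaussian (b := (Real.pi * t : ℝ)) (by simpa using by positivity)
    (-(2 * Real.pi * ξ))
  have hπ : (Real.pi : ℂ) ≠ 0 := by exact_mod_cast Real.pi_ne_zero
  have ht' : (t : ℂ) ≠ 0 := by exact_mod_cast ht.ne'
  have e1 : (Real.pi / (Real.pi * t : ℝ) : ℂ) ^ (1 / 2 : ℂ) = (√t : ℂ)⁻¹ := by
    have : (Real.pi / (Real.pi * t : ℝ) : ℂ) = ((1 / t : ℝ) : ℂ) := by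
      push_cast; field_simp
    rw [this, show (1 / 2 : ℂ) = ((1 / 2 : ℝ) : ℂ) by norm_num,
      ← Complex.ofReal_cpow (by positivity), ← Real.sqrt_eq_rpow, Real.sqrt_div zero_le_one,
      Real.sqrt_one]
    push_cast
    rw [one_div]
  rw [e1] at h
  convert h using 1
  · refine integral_congr_ae (Eventually.of_forall fun u ↦ ?_)
    simp only [gaussianMoment, pow_zero, one_mul]
    rw [← Complex.exp_add]
    congr 1
    push_cast
    ring
  · congr 2
    push_cast
    field_simp
    ring

/-- Formally this is completing the square and shifting `u` by `iξ/t`. The shift of contour is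
avoided: both sides satisfy the same two-step recursion in `p`, and the case `p = 0` is the
transform of a Gaussian. -/
theorem integral_gaussianMoment (ε : ℝ) {t : ℝ} (ht : 0 < t) (ξ : ℝ) (p : ℕ) :
    ∫ u, gaussianMoment ε t ξ p u = ((√t : ℂ) ^ (p + 1))⁻¹ *
      Complex.exp (-(Real.pi * ξ ^ 2 / t)) * hermiteI p (√t * (ξ / t + ε)) := by
  have hπ : (Real.pi : ℂ) ≠ 0 := by exact_mod_cast Real.pi_ne_zero
  have hr : (√t : ℂ) ≠ 0 := by exact_mod_cast (Real.sqrt_pos.2 ht).ne'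
  have hrt : (t : ℂ) = (√t : ℂ) ^ 2 := by
    rw [← Complex.ofReal_pow, Real.sq_sqrt ht.le]
  set r := (√t : ℂ)
  induction p using Nat.twoStepInduction with
  | zero => rw [integral_gaussianMoment_zero ε ht]; simp [hermiteI, r]
  | one =>
    have h := integral_gaussianMoment_rec ε ht ξ 0
    rw [integral_gaussianMoment_zero ε ht] at h
    simp only [hermiteI]
    push_cast at h ⊢
    rw [show (√t : ℂ) = r from rfl, hrt] at h
    rw [hrt]
    set E := Complex.exp (-(Real.pi * ξ ^ 2 / r ^ 2))
    have e : ∫ u, gaussianMoment ε t ξ (0 + 1) u =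
        -(2 * Real.pi * Complex.I * (r ^ 2 * ε + ξ) * (r⁻¹ * E)) / (2 * Real.pi * r ^ 2) := by
      rw [eq_div_iff (by simp [hπ, hr])]
      linear_combination -h
    rw [zero_add] at e
    rw [e]
    change _ = _ * (-Complex.I * (r * _))
    field_simp
    ring
  | more p h1 h2 =>
    have h := integral_gaussianMoment_rec ε ht ξ (p + 1)
    rw [Nat.add_sub_cancel, h1, h2] at h
    simp only [hermiteI]
    set H1 := hermiteI (p + 1) (√t * (ξ / t + ε))
    set H0 := hermiteI p (√t * (ξ / t + ε))
    push_cast at h ⊢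
    rw [hrt] at h ⊢
    set E := Complex.exp (-(Real.pi * ξ ^ 2 / r ^ 2))
    have e : ∫ u, gaussianMoment ε t ξ (p + 1 + 1) u =
        ((p + 1) * ((r ^ (p + 1))⁻¹ * E * H0) - 2 * Real.pi * Complex.I * (r ^ 2 * ε + ξ) *
          ((r ^ (p + 1 + 1))⁻¹ * E * H1)) / (2 * Real.pi * r ^ 2) := by
      rw [eq_div_iff (by simp [hπ, hr])]
      linear_combination -h
    rw [show p + 2 = p + 1 + 1 from rfl, e]
    change _ = _ * (-Complex.I * (r * _) * _ + _)
    field_simp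
    ring

/-! ### The Fourier transform of the inner summand. -/

/-- The function whose translates are summed in the inner sum of the Eisenstein series. -/
def latticeFun (κ : ℕ) (ε : ℝ) (s : ℂ) (v : ℝ) : ℂ :=
  ((v : ℂ) - Complex.I * ε) ^ (2 * κ) * ((v ^ 2 + 1 : ℝ) : ℂ) ^ (-(s + κ))

theorem continuous_latticeFun (κ : ℕ) (ε : ℝ) (s : ℂ) : Continuous (latticeFun κ ε s) := by
  unfold latticeFun
  refine Continuous.mul (by fun_prop) ?_
  refine Continuous.cpow (by fun_prop) continuous_const fun v ↦ ?_
  exact Complex.ofReal_mem_slitPlane.2 (by positivity)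

theorem norm_sub_I_mul_sq {ε : ℝ} (hε : ε ^ 2 = 1) (v : ℝ) :
    ‖(v : ℂ) - Complex.I * ε‖ ^ 2 = v ^ 2 + 1 := by
  rw [← Complex.normSq_eq_norm_sq, Complex.normSq_apply]
  simp
  linarith

/-- As `|v - iε|² = v² + 1`, the weight `κ` drops out of the absolute value. -/
theorem norm_latticeFun (κ : ℕ) {ε : ℝ} (hε : ε ^ 2 = 1) (s : ℂ) (v : ℝ) :
    ‖latticeFun κ ε s v‖ = (1 + ‖v‖ ^ 2) ^ (-(2 * s.re) / 2) := by
  have h : 0 < v ^ 2 + 1 := by positivity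
  rw [latticeFun, norm_mul, norm_pow, pow_mul, norm_sub_I_mul_sq hε,
    Complex.norm_cpow_eq_rpow_re_of_pos h, ← Real.rpow_natCast, ← Real.rpow_add h,
    Real.norm_eq_abs, sq_abs, add_comm 1]
  congr 1
  simp
  ring

theorem integrable_latticeFun (κ : ℕ) {ε : ℝ} (hε : ε ^ 2 = 1) {s : ℂ} (hs : 1 / 2 < s.re) :
    Integrable (latticeFun κ ε s) := by
  have h : Integrable (fun v : ℝ ↦ (1 + ‖v‖ ^ 2) ^ (-(2 * s.re) / 2)) :=
    integrable_rpow_neg_one_add_norm_sq (by simp; linarith)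
  exact h.mono' (continuous_latticeFun κ ε s).aestronglyMeasurable
    (Eventually.of_forall fun v ↦ (norm_latticeFun κ hε s v).le)

/-- The function whose Mellin transform is the Fourier transform of `latticeFun`. -/
def fourierKernel (κ : ℕ) (ε ξ t : ℝ) : ℂ :=
  hermiteI (2 * κ) (√t * (ξ / t + ε)) * (Real.exp (-(Real.pi * (t + ξ ^ 2 / t))) : ℝ)

/-- The double integrand used to compute the Fourier transform of `latticeFun`. -/
def doubleIntegrand (κ : ℕ) (ε ξ : ℝ) (s : ℂ) (v t : ℝ) : ℂ :=
  (t : ℂ) ^ (s + κ - 1) * Complex.exp (-(Real.pi * t)) * gaussianMoment ε t ξ (2 * κ) v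

theorem norm_doubleIntegrand (κ : ℕ) {ε : ℝ} (hε : ε ^ 2 = 1) (ξ : ℝ) (s : ℂ) (v : ℝ) {t : ℝ}
    (ht : 0 < t) : ‖doubleIntegrand κ ε ξ s v t‖ = (v ^ 2 + 1) ^ κ *
      (t ^ (s.re + κ - 1) * Real.exp (-(Real.pi * (v ^ 2 + 1) * t))) := by
  have e1 : ‖Complex.exp (-(Real.pi * t))‖ = Real.exp (-(Real.pi * t)) := by
    rw [Complex.norm_exp]; simp
  rw [doubleIntegrand, norm_mul, norm_mul, norm_gaussianMoment, e1, pow_mul, norm_sub_I_mul_sq hε,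
    Complex.norm_cpow_eq_rpow_re_of_pos ht]
  have e2 : Real.exp (-(Real.pi * (v ^ 2 + 1) * t)) =
      Real.exp (-(Real.pi * t)) * Real.exp (-(Real.pi * t * v ^ 2)) := by
    rw [← Real.exp_add]; ring_nf
  rw [e2]
  simp
  ring

theorem integrable_doubleIntegrand (κ : ℕ) {ε : ℝ} (hε : ε ^ 2 = 1) (ξ : ℝ) {s : ℂ}
    (hs : 1 / 2 < s.re) : Integrable (Function.uncurry (doubleIntegrand κ ε ξ s))
      (volume.prod (volume.restrict (Set.Ioi 0))) := by
  have hmeas : Measurable (Function.uncurry (doubleIntegrand κ ε ξ s)) := by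
    unfold doubleIntegrand gaussianMoment Function.uncurry
    fun_prop
  have hκ : (0 : ℝ) ≤ κ := Nat.cast_nonneg κ
  rw [integrable_prod_iff hmeas.aestronglyMeasurable]
  constructor
  · refine Eventually.of_forall fun v ↦ ?_
    have h := ((integrableOn_rpow_mul_exp_neg_mul_rpow (p := 1) (s := s.re + κ - 1)
      (b := Real.pi * (v ^ 2 + 1)) (by linarith) one_pos (by positivity)).integrable).const_mul
      ((v ^ 2 + 1) ^ κ)
    refine h.mono' (hmeas.comp measurable_prodMk_left).aestronglyMeasurable ?_
    filter_upwards [ae_restrict_mem measurableSet_Ioi] with t ht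
    simp only [Function.uncurry_apply_pair]
    rw [norm_doubleIntegrand κ hε ξ s v ht, Real.rpow_one, neg_mul]
  -- The inner integral of the norm over `t` is a Gamma integral, equal to a constant times
  -- `‖latticeFun κ ε s v‖`.
  · have h := ((integrable_latticeFun κ hε hs).norm).const_mul
      (Real.pi ^ (-(s.re + κ)) * Real.Gamma (s.re + κ))
    refine h.congr (Eventually.of_forall fun v ↦ ?_)
    simp only [Function.uncurry_apply_pair]
    have hv : 0 < v ^ 2 + 1 := by positivity
    have e : ∫ t in Set.Ioi 0, ‖doubleIntegrand κ ε ξ s v t‖ = ∫ t in Set.Ioi 0,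
        (v ^ 2 + 1) ^ κ * (t ^ (s.re + κ - 1) * Real.exp (-(Real.pi * (v ^ 2 + 1) * t))) :=
      setIntegral_congr_fun measurableSet_Ioi fun t ht ↦ norm_doubleIntegrand κ hε ξ s v ht
    rw [e, integral_const_mul, Real.integral_rpow_mul_exp_neg_mul_Ioi (by linarith) (by positivity),
      latticeFun, norm_mul, norm_pow, pow_mul, norm_sub_I_mul_sq hε,
      Complex.norm_cpow_eq_rpow_re_of_pos hv, one_div, Real.inv_rpow (by positivity),
      ← Real.rpow_neg (by positivity), Real.mul_rpow Real.pi_pos.le hv.le]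
    simp
    ring

/-- Fubini for `doubleIntegrand`: integrating in `t` first gives the Gamma integral for `(v² +
1)^(-(s+κ))`, integrating in `v` first gives a Gaussian moment. The factor `t^(-κ-1/2)` of that
moment shifts the Mellin variable from `s + κ` to `s - 1/2`. -/
theorem fourier_latticeFun_eq_mellin (κ : ℕ) {ε : ℝ} (hε : ε ^ 2 = 1) (ξ : ℝ) {s : ℂ}
    (hs : 1 / 2 < s.re) :
    Complex.Gamma (s + κ) * (Real.pi : ℂ) ^ (-(s + κ)) *
      ∫ v : ℝ, latticeFun κ ε s v * Complex.exp (-(2 * Real.pi * Complex.I * ξ * v)) =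
        mellin (fourierKernel κ ε ξ) (s - 1 / 2) := by
  have hκ : (0 : ℝ) ≤ κ := Nat.cast_nonneg κ
  have hswap := integral_integral_swap (integrable_doubleIntegrand κ hε ξ hs)
  have h1 (v : ℝ) : ∫ t in Set.Ioi 0, doubleIntegrand κ ε ξ s v t =
      Complex.Gamma (s + κ) * (Real.pi : ℂ) ^ (-(s + κ)) *
        (latticeFun κ ε s v * Complex.exp (-(2 * Real.pi * Complex.I * ξ * v))) := by
    have hv : 0 < v ^ 2 + 1 := by positivity
    have h := Complex.integral_cpow_mul_exp_neg_mul_Ioi (a := s + κ) (r := Real.pi * (v ^ 2 + 1))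
      (by simp; linarith) (by positivity)
    have e : ∀ t ∈ Set.Ioi (0 : ℝ), doubleIntegrand κ ε ξ s v t =
        ((v : ℂ) - Complex.I * ε) ^ (2 * κ) *
          Complex.exp (-(2 * Real.pi * Complex.I * ξ * v)) * ((t : ℂ) ^ (s + κ - 1) *
          Complex.exp (-(((Real.pi * (v ^ 2 + 1) : ℝ) : ℂ) * t))) := by
      intro t _
      rw [doubleIntegrand, gaussianMoment]
      have : Complex.exp (-(Real.pi * t)) *
          Complex.exp (-(Real.pi * t * v ^ 2) - 2 * Real.pi * Complex.I * ξ * v) =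
          Complex.exp (-(2 * Real.pi * Complex.I * ξ * v)) *
          Complex.exp (-(((Real.pi * (v ^ 2 + 1) : ℝ) : ℂ) * t)) := by
        rw [← Complex.exp_add, ← Complex.exp_add]
        congr 1
        push_cast
        ring
      linear_combination (t : ℂ) ^ (s + κ - 1) * ((v : ℂ) - Complex.I * ε) ^ (2 * κ) * this
    rw [setIntegral_congr_fun measurableSet_Ioi e, integral_const_mul, h, latticeFun]
    have e2 : (1 / ((Real.pi * (v ^ 2 + 1) : ℝ) : ℂ)) ^ (s + κ) =
        (Real.pi : ℂ) ^ (-(s + κ)) * ((v ^ 2 + 1 : ℝ) : ℂ) ^ (-(s + κ)) := by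
      rw [← Complex.mul_cpow_ofReal_nonneg Real.pi_pos.le hv.le, ← Complex.ofReal_mul, one_div,
        Complex.inv_cpow, ← Complex.cpow_neg]
      rw [Complex.arg_ofReal_of_nonneg (by positivity)]
      exact Real.pi_pos.ne
    rw [e2]
    ring
  have h2 : ∀ t ∈ Set.Ioi (0 : ℝ), ∫ v, doubleIntegrand κ ε ξ s v t =
      (t : ℂ) ^ (s - 1 / 2 - 1) • fourierKernel κ ε ξ t := by
    intro t ht
    have ht' : 0 < t := ht
    have ht0 : (t : ℂ) ≠ 0 := by exact_mod_cast ht'.ne'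
    simp only [doubleIntegrand]
    rw [integral_const_mul, integral_gaussianMoment ε ht', fourierKernel, smul_eq_mul]
    have e1 : ((√t : ℂ) ^ (2 * κ + 1))⁻¹ = (t : ℂ) ^ (-(κ + 1 / 2) : ℂ) := by
      rw [Real.sqrt_eq_rpow, Complex.ofReal_cpow ht'.le, ← Complex.cpow_nat_mul, ← Complex.cpow_neg]
      congr 1
      push_cast
      ring
    have e2 : (t : ℂ) ^ (s - 1 / 2 - 1) = (t : ℂ) ^ (s + κ - 1) * (t : ℂ) ^ (-(κ + 1 / 2) : ℂ) := by
      rw [← Complex.cpow_add _ _ ht0]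
      congr 1
      ring
    have e3 : ((Real.exp (-(Real.pi * (t + ξ ^ 2 / t))) : ℝ) : ℂ) =
        Complex.exp (-(Real.pi * t)) * Complex.exp (-(Real.pi * ξ ^ 2 / t)) := by
      rw [← Complex.exp_add]
      push_cast
      congr 1
      ring
    rw [e1, e2, e3]
    ring
  calc _ = ∫ v, ∫ t in Set.Ioi 0, doubleIntegrand κ ε ξ s v t := by
        rw [← integral_const_mul]
        exact integral_congr_ae (Eventually.of_forall fun v ↦ (h1 v).symm)
    _ = ∫ t in Set.Ioi 0, ∫ v, doubleIntegrand κ ε ξ s v t := hswap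
    _ = _ := setIntegral_congr_fun measurableSet_Ioi h2

/-- The substitution `t = |ξ| τ` makes the exponent symmetric, turning `t + ξ²/t` into `|ξ| (τ +
1/τ)`. -/
theorem mellin_fourierKernel (κ : ℕ) (ε : ℝ) {ξ : ℝ} (hξ : ξ ≠ 0) (s : ℂ) :
    mellin (fourierKernel κ ε ξ) (s - 1 / 2) = ((|ξ| : ℝ) : ℂ) ^ (s - 1 / 2) *
      besselIntegral κ ε (SignType.sign ξ) |ξ| s := by
  have ha : 0 < |ξ| := abs_pos.2 hξ
  have ha' : ((|ξ| : ℝ) : ℂ) ≠ 0 := by exact_mod_cast ha.ne'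
  have h := mellin_comp_mul_left (fourierKernel κ ε ξ) (s - 1 / 2) ha
  have h2 : mellin (fun t ↦ fourierKernel κ ε ξ (|ξ| * t)) (s - 1 / 2) =
      besselIntegral κ ε (SignType.sign ξ) |ξ| s := by
    refine setIntegral_congr_fun measurableSet_Ioi fun τ hτ ↦ ?_
    have hτ' : 0 < τ := hτ
    have e0 : ξ = SignType.sign ξ * |ξ| := (sign_mul_abs ξ).symm
    have e1 : √(|ξ| * τ) * (ξ / (|ξ| * τ) + ε) =
        √|ξ| * (ε * √τ + (SignType.sign ξ : ℝ) / √τ) := by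
      have hs : (√τ) ^ 2 = τ := Real.sq_sqrt hτ'.le
      have hs0 : √τ ≠ 0 := (Real.sqrt_pos.2 hτ').ne'
      have : ξ / (|ξ| * τ) = (SignType.sign ξ : ℝ) / τ := by
        nth_rewrite 1 [e0]
        field_simp
      rw [this, Real.sqrt_mul ha.le]
      nth_rewrite 2 [← hs]
      field_simp
      ring
    have e2 : |ξ| * τ + ξ ^ 2 / (|ξ| * τ) = |ξ| * (τ + 1 / τ) := by
      rw [← sq_abs ξ]
      field_simp
    simp only [fourierKernel, besselKernel, e1, e2]
  rw [h2] at h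
  rw [h, smul_eq_mul, ← mul_assoc, ← Complex.cpow_add _ _ ha', add_neg_cancel, Complex.cpow_zero,
    one_mul]

theorem mellin_fourierKernel_zero (ε : ℝ) {s : ℂ} (hs : 1 / 2 < s.re) :
    mellin (fourierKernel 0 ε 0) (s - 1 / 2) =
      (Real.pi : ℂ) ^ (-(s - 1 / 2)) * Complex.Gamma (s - 1 / 2) := by
  have h := Complex.integral_cpow_mul_exp_neg_mul_Ioi (a := s - 1 / 2) (r := Real.pi)
    (by simp; linarith) Real.pi_pos
  have e : (1 / (Real.pi : ℂ)) ^ (s - 1 / 2) = (Real.pi : ℂ) ^ (-(s - 1 / 2)) := by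
    rw [one_div, Complex.inv_cpow, ← Complex.cpow_neg]
    rw [Complex.arg_ofReal_of_nonneg Real.pi_pos.le]
    exact Real.pi_pos.ne
  rw [← e, ← h]
  refine setIntegral_congr_fun measurableSet_Ioi fun t _ ↦ ?_
  simp [fourierKernel, hermiteI]

/-- Integrate the derivative of `(v - iε)^(2κ+1) (v² + 1)^(-(s+κ))`, with `2v = (v - iε) + (v + iε)`
and `v² + 1 = (v - iε)(v + iε)`. -/
theorem integral_latticeFun_succ (κ : ℕ) {ε : ℝ} (hε : ε ^ 2 = 1) {s : ℂ} (hs : 1 < s.re) :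
    (s + κ) * ∫ v, latticeFun (κ + 1) ε s v = (1 - s + κ) * ∫ v, latticeFun κ ε s v := by
  have hi1 := (integrable_latticeFun (κ + 1) hε (s := s) (by linarith)).const_mul (s + κ)
  have hi0 := (integrable_latticeFun κ hε (s := s) (by linarith)).const_mul (1 - s + κ)
  set h : ℝ → ℂ := fun v ↦
    ((v : ℂ) - Complex.I * ε) ^ (2 * κ + 1) * ((v ^ 2 + 1 : ℝ) : ℂ) ^ (-(s + κ))
  have hεc : (ε : ℂ) ^ 2 = 1 := by exact_mod_cast hε
  have hd (v : ℝ) : HasDerivAt h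
      ((1 - s + κ) * latticeFun κ ε s v - (s + κ) * latticeFun (κ + 1) ε s v) v := by
    have hv : 0 < v ^ 2 + 1 := by positivity
    have hv0 : ((v ^ 2 + 1 : ℝ) : ℂ) ≠ 0 := by exact_mod_cast hv.ne'
    have e0 : HasDerivAt (fun u : ℝ ↦ (u : ℂ)) 1 v := Complex.ofRealCLM.hasDerivAt
    have e1 := (e0.sub_const (Complex.I * ε)).pow (2 * κ + 1)
    have e2 : HasDerivAt (fun u : ℝ ↦ ((u ^ 2 + 1 : ℝ) : ℂ)) (2 * v : ℂ) v := by
      have := ((hasDerivAt_id v).pow 2).add_const 1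
      have := this.ofReal_comp
      simpa using this
    have e3 := HasDerivAt.comp v (((hasDerivAt_id ((v ^ 2 + 1 : ℝ) : ℂ)).cpow_const
      (c := -(s + κ)) (Complex.ofReal_mem_slitPlane.2 hv))) e2
    refine (e1.mul e3).congr_deriv ?_
    have e4 : ((v ^ 2 + 1 : ℝ) : ℂ) ^ (-(s + κ)) =
        ((v ^ 2 + 1 : ℝ) : ℂ) ^ (-(s + κ) - 1) * ((v ^ 2 + 1 : ℝ) : ℂ) := by
      rw [Complex.cpow_sub _ _ hv0, Complex.cpow_one]
      field_simp
    have e5 : (-(s + ((κ + 1 : ℕ) : ℂ))) = -(s + κ) - 1 := by push_cast; ring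
    simp only [latticeFun, e5, Pi.pow_apply, Function.comp_apply, id_eq, e4]
    have e6 : ((v ^ 2 + 1 : ℝ) : ℂ) =
        ((v : ℂ) - Complex.I * ε) * ((v : ℂ) + Complex.I * ε) := by
      push_cast
      linear_combination (-1 : ℂ) * hεc + (ε : ℂ) ^ 2 * Complex.I_sq
    generalize ((v ^ 2 + 1 : ℝ) : ℂ) ^ (-(s + κ) - 1) = P
    rw [e6, show 2 * (κ + 1) = 2 * κ + 1 + 1 by ring]
    simp only [Nat.add_one_sub_one, mul_one]
    push_cast
    ring
  have hint : Integrable h := by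
    have hI : Integrable (fun v : ℝ ↦ (1 + ‖v‖ ^ 2) ^ (-(2 * s.re - 1) / 2)) :=
      integrable_rpow_neg_one_add_norm_sq (by simp; linarith)
    refine hI.mono' ?_ (Eventually.of_forall fun v ↦ le_of_eq ?_)
    · exact (continuous_iff_continuousAt.2 fun v ↦ (hd v).continuousAt).aestronglyMeasurable
    · have e : h v = ((v : ℂ) - Complex.I * ε) * latticeFun κ ε s v := by
        simp only [h, latticeFun]; ring
      have hv : 0 < v ^ 2 + 1 := by positivity
      rw [e, norm_mul, norm_latticeFun κ hε, ← Real.sqrt_sq (norm_nonneg ((v : ℂ) - _)),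
        norm_sub_I_mul_sq hε, Real.sqrt_eq_rpow, Real.norm_eq_abs, sq_abs, add_comm 1,
        ← Real.rpow_add hv]
      congr 1
      ring
  have := integral_eq_zero_of_hasDerivAt_of_integrable hd (hi0.sub hi1) hint
  rw [integral_sub hi0 hi1, integral_const_mul, integral_const_mul] at this
  linear_combination -this

/-- Each step in `κ` trades a factor `s + κ`, absorbed by the Gamma function, for `1 - s + κ`. This
is how the rising product at `1 - s` enters the constant term. -/
theorem Gamma_mul_integral_latticeFun (κ : ℕ) {ε : ℝ} (hε : ε ^ 2 = 1) {s : ℂ} (hs : 1 < s.re) :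
    Complex.Gamma (s + κ) * (Real.pi : ℂ) ^ (-s) * ∫ v, latticeFun κ ε s v =
      (∏ j ∈ Finset.range κ, (1 - s + (j : ℂ))) *
        ((Real.pi : ℂ) ^ (-(s - 1 / 2)) * Complex.Gamma (s - 1 / 2)) := by
  induction κ with
  | zero =>
    have h := fourier_latticeFun_eq_mellin 0 hε 0 (s := s) (by linarith)
    rw [mellin_fourierKernel_zero ε (by linarith)] at h
    simpa using h
  | succ κ ih =>
    have hne : s + κ ≠ 0 := by
      intro h
      have := congrArg Complex.re h
      simp at this
      linarith [(Nat.cast_nonneg κ : (0 : ℝ) ≤ κ)]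
    have h := integral_latticeFun_succ κ hε hs
    rw [Finset.prod_range_succ]
    push_cast
    rw [← add_assoc, Complex.Gamma_add_one _ hne]
    linear_combination Complex.Gamma (s + κ) * (Real.pi : ℂ) ^ (-s) * h + (1 - s + κ) * ih

theorem fourier_latticeFun_comp_div (κ : ℕ) (ε : ℝ) (s : ℂ) {Y : ℝ} (hY : 0 < Y) (ξ : ℝ) :
    𝓕 (fun v : ℝ ↦ latticeFun κ ε s (v / Y)) ξ =
      Y * ∫ v : ℝ, latticeFun κ ε s v *
        Complex.exp (-(2 * Real.pi * Complex.I * ((ξ * Y : ℝ) : ℂ) * v)) := by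
  rw [Real.fourier_real_eq_integral_exp_smul]
  have h := Measure.integral_comp_div (fun v : ℝ ↦ latticeFun κ ε s v *
        Complex.exp (-(2 * Real.pi * Complex.I * ((ξ * Y : ℝ) : ℂ) * v))) Y
  rw [abs_of_pos hY, Complex.real_smul] at h
  rw [← h]
  have hY' : (Y : ℂ) ≠ 0 := by exact_mod_cast hY.ne'
  refine integral_congr_ae (Eventually.of_forall fun v ↦ ?_)
  simp only [smul_eq_mul]
  rw [mul_comm]
  congr 2
  push_cast
  field_simp

theorem isBigO_latticeFun_comp_div (κ : ℕ) {ε : ℝ} (hε : ε ^ 2 = 1) {s : ℂ} (hs : 0 ≤ s.re)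
    {Y : ℝ} (hY : 0 < Y) :
    (fun v : ℝ ↦ latticeFun κ ε s (v / Y)) =O[cocompact ℝ] fun v ↦ |v| ^ (-(2 * s.re)) := by
  refine Asymptotics.IsBigO.of_bound (Y ^ (2 * s.re)) ?_
  filter_upwards [(isCompact_singleton (x := (0 : ℝ))).compl_mem_cocompact] with v hv
  have hv0 : 0 < |v| := abs_pos.2 hv
  rw [norm_latticeFun κ hε, Real.norm_eq_abs, Real.norm_eq_abs,
    abs_of_nonneg (by positivity : (0 : ℝ) ≤ |v| ^ (-(2 * s.re)))]
  have hvY : 0 < |v / Y| := by rw [abs_div]; positivity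
  have e : Y ^ (2 * s.re) * |v| ^ (-(2 * s.re)) = (|v / Y| ^ 2) ^ (-(2 * s.re) / 2) := by
    rw [← Real.rpow_natCast, ← Real.rpow_mul (abs_nonneg _), abs_div, abs_of_pos hY,
      Real.div_rpow hv0.le hY.le, div_eq_mul_inv, ← Real.rpow_neg hY.le, mul_comm]
    congr 2 <;> push_cast <;> ring
  rw [e]
  exact Real.rpow_le_rpow_of_nonpos (by positivity) (by linarith) (by linarith)

/-! ### Poisson summation for each row. -/

theorem ofReal_cpow_eq_exp {a : ℝ} (ha : 0 < a) (t : ℂ) :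
    (a : ℂ) ^ t = Complex.exp (Real.log a * t) := by
  rw [Complex.cpow_def_of_ne_zero (by exact_mod_cast ha.ne'), Complex.ofReal_log ha.le]

theorem exponent_identity {y m l : ℝ} (hy : 0 < y) (hm : 0 < m) (hl : 0 < l) (s : ℂ) :
    (y : ℂ) ^ s * ((m * y : ℝ) : ℂ) ^ (-(2 * s)) * ((m * y : ℝ) : ℂ) *
      ((l * (m * y) : ℝ) : ℂ) ^ (s - 1 / 2) = (√y : ℂ) * ((l / m : ℝ) : ℂ) ^ (s - 1 / 2) := by
  have e1 : ((m * y : ℝ) : ℂ) = ((m * y : ℝ) : ℂ) ^ (1 : ℂ) := (Complex.cpow_one _).symm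
  have e2 : (√y : ℂ) = (y : ℂ) ^ (1 / 2 : ℂ) := by
    rw [Real.sqrt_eq_rpow, Complex.ofReal_cpow hy.le]
    norm_num
  nth_rewrite 2 [e1]
  have hmy : 0 < m * y := by positivity
  have hlmy : 0 < l * (m * y) := by positivity
  have hlm : 0 < l / m := by positivity
  rw [e2]
  simp only [ofReal_cpow_eq_exp hy, ofReal_cpow_eq_exp hmy, ofReal_cpow_eq_exp hlmy,
    ofReal_cpow_eq_exp hlm]
  rw [← Complex.exp_add, ← Complex.exp_add, ← Complex.exp_add,
    ← Complex.exp_add, Real.log_mul hl.ne' (by positivity), Real.log_mul hm.ne' hy.ne',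
    Real.log_div hl.ne' hm.ne']
  congr 1
  push_cast
  ring

/-- The contribution of the frequency zero for a given `m`. -/
def zeroTerm (κ : ℕ) (z : ℍ) (s : ℂ) (m : ℕ+) : ℂ :=
  (z.im : ℂ) ^ s * ((m * z.im : ℝ) : ℂ) ^ (-(2 * s)) * ((m * z.im : ℝ) : ℂ) *
    ((∏ j ∈ Finset.range κ, (1 - s + (j : ℂ))) *
      ((Real.pi : ℂ) ^ (-(s - 1 / 2)) * Complex.Gamma (s - 1 / 2)))

theorem mul_fourier_latticeFun (κ : ℕ) {ε : ℝ} (hε : ε ^ 2 = 1) {s : ℂ} (hs : 1 < s.re) (z : ℍ)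
    (m : ℕ+) (l : ℤ) :
    Complex.Gamma (s + κ) * (Real.pi : ℂ) ^ (-s) * ((z.im : ℂ) ^ s *
      ((m * z.im : ℝ) : ℂ) ^ (-(2 * s))) *
        (𝓕 (fun v : ℝ ↦ latticeFun κ ε s (v / (m * z.im))) l *
          fourier l ((m * z.re : ℝ) : UnitAddCircle)) =
      (if l = 0 then zeroTerm κ z s m else 0) + (Real.pi : ℂ) ^ κ * fourierTerm κ ε z (m, l) s := by
  have hy := z.im_pos
  have hm : (0 : ℝ) < m := by exact_mod_cast m.pos
  have hY : 0 < m * z.im := by positivity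
  rw [fourier_latticeFun_comp_div κ ε s hY, fourier_coe_apply]
  by_cases hl : l = 0
  · subst hl
    have h := Gamma_mul_integral_latticeFun κ hε hs
    simp only [fourierTerm, zeroTerm, if_true]
    rw [← h]
    simp
    ring
  · have hl0 : (l : ℝ) ≠ 0 := by exact_mod_cast hl
    have hξ : (l : ℝ) * (m * z.im) ≠ 0 := mul_ne_zero hl0 hY.ne'
    have h := fourier_latticeFun_eq_mellin κ hε (l * (m * z.im)) (s := s) (by linarith)
    rw [mellin_fourierKernel κ ε hξ s, abs_mul, abs_of_pos hY, sign_mul, sign_pos hY, mul_one] at h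
    have hπ : (Real.pi : ℂ) ^ (-s) = (Real.pi : ℂ) ^ κ * (Real.pi : ℂ) ^ (-(s + κ)) := by
      rw [← Complex.cpow_natCast, ← Complex.cpow_add _ _ (by exact_mod_cast Real.pi_ne_zero)]
      congr 1
      ring
    have hE := exponent_identity hy hm (abs_pos.2 hl0) s
    have hexp : Complex.exp (2 * Real.pi * Complex.I * l * ((m * z.re : ℝ) : ℂ) / ((1 : ℝ) : ℂ)) =
        Complex.exp (2 * Real.pi * Complex.I * (l * (m * z.re))) := by
      congr 1
      push_cast
      ring
    simp only [fourierTerm, hl, if_false, zero_add]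
    rw [hexp, hπ, ← hE]
    linear_combination (Real.pi : ℂ) ^ κ * ((z.im : ℂ) ^ s * ((m * z.im : ℝ) : ℂ) ^ (-(2 * s))) *
      ((m * z.im : ℝ) : ℂ) * Complex.exp (2 * Real.pi * Complex.I * (l * (m * z.re))) * h

theorem Gamma_add_natCast_ne_zero (κ : ℕ) {s : ℂ} (hs : 0 < s.re) :
    Complex.Gamma (s + κ) ≠ 0 :=
  Complex.Gamma_ne_zero_of_re_pos (by
    simp only [Complex.add_re, Complex.natCast_re]
    linarith [(Nat.cast_nonneg κ : (0 : ℝ) ≤ κ)])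

/-- Poisson summation for the inner sum of the Eisenstein series. -/
theorem mul_tsum_latticeFun (κ : ℕ) {ε : ℝ} (hε : ε ^ 2 = 1) {s : ℂ} (hs : 1 < s.re) (z : ℍ)
    (m : ℕ+) :
    Complex.Gamma (s + κ) * (Real.pi : ℂ) ^ (-s) * ((z.im : ℂ) ^ s *
      ((m * z.im : ℝ) : ℂ) ^ (-(2 * s)) *
        ∑' n : ℤ, latticeFun κ ε s ((m * z.re + n) / (m * z.im))) =
      zeroTerm κ z s m + (Real.pi : ℂ) ^ κ * ∑' l : ℤ, fourierTerm κ ε z (m, l) s := by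
  have hy := z.im_pos
  have hm : (0 : ℝ) < m := by exact_mod_cast m.pos
  have hY : 0 < m * z.im := by positivity
  set c := Complex.Gamma (s + κ) * (Real.pi : ℂ) ^ (-s) * ((z.im : ℂ) ^ s *
      ((m * z.im : ℝ) : ℂ) ^ (-(2 * s))) with hc
  have hc0 : c ≠ 0 := by
    have h1 : (Real.pi : ℂ) ≠ 0 := by exact_mod_cast Real.pi_ne_zero
    have h2 : (z.im : ℂ) ≠ 0 := by exact_mod_cast hy.ne'
    have h3 : ((m * z.im : ℝ) : ℂ) ≠ 0 := by exact_mod_cast hY.ne'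
    exact mul_ne_zero (mul_ne_zero (Gamma_add_natCast_ne_zero κ (by linarith))
      (by simp [Complex.cpow_eq_zero_iff, h1])) (mul_ne_zero (by simp [Complex.cpow_eq_zero_iff, h2])
        (by rw [Ne, Complex.cpow_eq_zero_iff]; exact fun h ↦ h3 h.1))
  have hterm := mul_fourier_latticeFun κ hε hs z m
  rw [← hc] at hterm
  have hs1 : Summable (fun l : ℤ ↦ if l = 0 then zeroTerm κ z s m else 0) :=
    summable_of_ne_finset_zero (s := {0}) (by simp +contextual)
  have hs2 : Summable (fun l : ℤ ↦ (Real.pi : ℂ) ^ κ * fourierTerm κ ε z (m, l) s) :=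
    ((summable_fourierTerm κ hε z s).comp_injective (Prod.mk_right_injective m)).mul_left _
  have hsum : Summable (fun l : ℤ ↦ 𝓕 (fun v : ℝ ↦ latticeFun κ ε s (v / (m * z.im))) l *
      fourier l ((m * z.re : ℝ) : UnitAddCircle)) := by
    -- Summability of the transforms, needed for Poisson summation, is read off from the already
    -- bounded Fourier terms. This is why `c ≠ 0` is needed.
    rw [← summable_mul_left_iff hc0]
    exact (hs1.add hs2).congr fun l ↦ (hterm l).symm
  have hF : Summable (fun l : ℤ ↦ 𝓕 (fun v : ℝ ↦ latticeFun κ ε s (v / (m * z.im))) l) := by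
    refine Summable.of_norm (hsum.norm.congr fun l ↦ ?_)
    rw [norm_mul, fourier_apply, Circle.norm_coe, mul_one]
  have hP := Real.tsum_eq_tsum_fourier_of_rpow_decay_of_summable
    (f := fun v : ℝ ↦ latticeFun κ ε s (v / (m * z.im)))
    ((continuous_latticeFun κ ε s).comp (continuous_id.div_const _)) (b := 2 * s.re)
    (by linarith) (isBigO_latticeFun_comp_div κ hε (by linarith) hY) hF (m * z.re)
  rw [hP, ← mul_assoc, ← hc, ← tsum_mul_left, tsum_congr hterm, hs1.tsum_add hs2, tsum_mul_left,
    tsum_ite_eq]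

/-- Here `y^s (my)^(1-2s) = y^(1-s) m^(1-2s)`, so the sum over `m` is `ζ(2s - 1)`. The functional
equation turns its completion into the one at `2(1 - s)`. -/
theorem hasSum_zeroTerm (κ : ℕ) (z : ℍ) {s : ℂ} (hs : 1 < s.re) :
    HasSum (zeroTerm κ z s) (completedRiemannZeta (2 * (1 - s)) *
      (∏ j ∈ Finset.range κ, (1 - s + (j : ℂ))) * (z.im : ℂ) ^ (1 - s)) := by
  have hy := z.im_pos
  have hy0 : (z.im : ℂ) ≠ 0 := by exact_mod_cast hy.ne'
  have h1 : 1 < (2 * s - 1).re := by simp; linarith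
  have hζ : HasSum (fun m : ℕ+ ↦ 1 / ((m : ℕ) : ℂ) ^ (2 * s - 1)) (riemannZeta (2 * s - 1)) := by
    have h0 : (fun n : ℕ ↦ 1 / (n : ℂ) ^ (2 * s - 1)) 0 = 0 := by
      have : 2 * s - 1 ≠ 0 := by intro h; rw [h] at h1; norm_num at h1
      simp [this]
    rw [zeta_eq_tsum_one_div_nat_cpow h1, ← tsum_pnat_eq_tsum_of_eq_zero h0]
    exact ((Complex.summable_one_div_nat_cpow.2 h1).comp_injective PNat.coe_injective).hasSum
  have hΛ : completedRiemannZeta (2 * (1 - s)) =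
      (Real.pi : ℂ) ^ (-(s - 1 / 2)) * Complex.Gamma (s - 1 / 2) * riemannZeta (2 * s - 1) := by
    have hne : 2 * s - 1 ≠ 0 := by intro h; rw [h] at h1; norm_num at h1
    rw [riemannZeta_def_of_ne_zero hne, show 2 * (1 - s) = 1 - (2 * s - 1) by ring,
      completedRiemannZeta_one_sub]
    have hG : Complex.Gammaℝ (2 * s - 1) ≠ 0 := Complex.Gammaℝ_ne_zero_of_re_pos (by linarith)
    have e : (Real.pi : ℂ) ^ (-(s - 1 / 2)) * Complex.Gamma (s - 1 / 2) =
        Complex.Gammaℝ (2 * s - 1) := by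
      rw [Complex.Gammaℝ_def]
      congr 2 <;> ring
    rw [e]
    field_simp
  have h2 := hζ.mul_left ((z.im : ℂ) ^ (1 - s) * ((∏ j ∈ Finset.range κ, (1 - s + (j : ℂ))) *
      ((Real.pi : ℂ) ^ (-(s - 1 / 2)) * Complex.Gamma (s - 1 / 2))))
  have hfun : zeroTerm κ z s = fun m : ℕ+ ↦ (z.im : ℂ) ^ (1 - s) *
      ((∏ j ∈ Finset.range κ, (1 - s + (j : ℂ))) *
        ((Real.pi : ℂ) ^ (-(s - 1 / 2)) * Complex.Gamma (s - 1 / 2))) *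
          (1 / ((m : ℕ) : ℂ) ^ (2 * s - 1)) := by
    funext m
    have hm : (0 : ℝ) < m := by exact_mod_cast m.pos
    have hm0 : ((m : ℝ) : ℂ) ≠ 0 := by exact_mod_cast hm.ne'
    have e : (z.im : ℂ) ^ s * ((m * z.im : ℝ) : ℂ) ^ (-(2 * s)) * ((m * z.im : ℝ) : ℂ) =
        (z.im : ℂ) ^ (1 - s) * (1 / ((m : ℕ) : ℂ) ^ (2 * s - 1)) := by
      have hmn : ((m : ℕ) : ℂ) = ((m : ℝ) : ℂ) := by push_cast; rfl
      rw [Complex.ofReal_mul, Complex.mul_cpow_ofReal_nonneg hm.le hy.le, one_div, hmn,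
        ← Complex.cpow_neg, show -(2 * s - 1) = -(2 * s) + 1 by ring,
        Complex.cpow_add _ _ hm0, Complex.cpow_one, show 1 - s = s + -(2 * s) + 1 by ring,
        Complex.cpow_add _ _ hy0, Complex.cpow_add _ _ hy0, Complex.cpow_one]
      ring
    rw [zeroTerm, e]
    ring
  rw [hfun, hΛ]
  refine (congrArg (HasSum _) ?_).mpr h2
  ring

/-! ### From cosets to the full lattice sum. -/

/-- The summand of the Eisenstein series as a function of the bottom row `(c, d)`. -/
def latticeSummand (k : ℤ) (z : ℍ) (s : ℂ) (x : Fin 2 → ℤ) : ℂ :=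
  (((x 0 : ℂ) * z + x 1) / (‖(x 0 : ℂ) * z + x 1‖ : ℂ)) ^ (-k) *
    ((z.im / ‖(x 0 : ℂ) * z + x 1‖ ^ 2 : ℝ) : ℂ) ^ s

theorem summand_eq_latticeSummand (k : ℤ) (z : ℍ) (s : ℂ) (g : SL(2, ℤ)) :
    summand k z s g = latticeSummand k z s (g 1) := by
  rw [summand, latticeSummand, autj, ModularGroup.im_smul_eq_div_normSq, Complex.normSq_eq_norm_sq,
    ModularGroup.denom_apply]

theorem latticeSummand_zero (k : ℤ) (z : ℍ) {s : ℂ} (hs : s ≠ 0) : latticeSummand k z s 0 = 0 := by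
  simp [latticeSummand, hs]

theorem latticeSummand_neg {k : ℤ} (hk : Even k) (z : ℍ) (s : ℂ) (x : Fin 2 → ℤ) :
    latticeSummand k z s (-x) = latticeSummand k z s x := by
  have e : (((-x) 0 : ℤ) : ℂ) * z + ((-x) 1 : ℤ) = -((x 0 : ℂ) * z + x 1) := by
    simp only [Pi.neg_apply]; push_cast; ring
  rw [latticeSummand, e, norm_neg, neg_div, hk.neg.neg_zpow, latticeSummand]

theorem latticeSummand_nsmul (k : ℤ) (z : ℍ) (s : ℂ) {n : ℕ} (hn : n ≠ 0) (x : Fin 2 → ℤ) :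
    latticeSummand k z s (n • x) = 1 / (n : ℂ) ^ (2 * s) * latticeSummand k z s x := by
  have hn0 : (0 : ℝ) < n := by positivity
  have hnc : ((n : ℝ) : ℂ) ≠ 0 := by exact_mod_cast hn0.ne'
  have e : (((n • x) 0 : ℤ) : ℂ) * z + ((n • x) 1 : ℤ) = ((n : ℝ) : ℂ) * ((x 0 : ℂ) * z + x 1) := by
    simp only [Pi.smul_apply, nsmul_eq_mul]; push_cast; ring
  have hnn : (n : ℂ) = ((n : ℝ) : ℂ) := by simp
  rw [latticeSummand, e, norm_mul, Complex.norm_real, Real.norm_eq_abs, abs_of_pos hn0,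
    Complex.ofReal_mul, mul_div_mul_left _ _ hnc, latticeSummand]
  set w := ‖(x 0 : ℂ) * z + x 1‖
  have e2 : z.im / (n * w) ^ 2 = ((n : ℝ) ^ 2)⁻¹ * (z.im / w ^ 2) := by
    rw [mul_pow, div_mul_eq_div_div]; ring
  have e3 : ((((n : ℝ) ^ 2)⁻¹ : ℝ) : ℂ) ^ s = 1 / (n : ℂ) ^ (2 * s) := by
    have hn2 : 0 < ((n : ℝ) ^ 2)⁻¹ := by positivity
    rw [one_div, ← Complex.cpow_neg, hnn, ofReal_cpow_eq_exp hn2, ofReal_cpow_eq_exp hn0,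
      Real.log_inv, Real.log_pow]
    congr 1
    push_cast
    ring
  rw [e2, Complex.ofReal_mul, Complex.mul_cpow_ofReal_nonneg (by positivity)
    (by have := z.im_pos; positivity), e3]
  ring

theorem norm_latticeSummand_le (k : ℤ) (z : ℍ) {s : ℂ} (hs : 1 < s.re) (x : Fin 2 → ℤ) :
    ‖latticeSummand k z s x‖ ≤
      z.im ^ s.re * (r z ^ (-(2 * s.re)) * ‖x‖ ^ (-(2 * s.re))) := by
  have hy := z.im_pos
  by_cases hx : x = 0
  · subst hx
    rw [latticeSummand_zero k z (by rintro rfl; norm_num at hs), norm_zero]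
    have := r_pos z
    positivity
  set w := (x 0 : ℂ) * z + x 1 with hw
  have hw0 : 0 < ‖w‖ :=
    (mul_pos (r_pos z) (norm_pos_iff.2 hx)).trans_le (r_mul_max_le z hx)
  have h1 : ‖w / (‖w‖ : ℂ)‖ = 1 := by
    rw [norm_div, Complex.norm_real, norm_norm, div_self hw0.ne']
  rw [latticeSummand, norm_mul, norm_zpow, h1, one_zpow, one_mul,
    Complex.norm_cpow_eq_rpow_re_of_pos (by positivity)]
  have h2 := summand_bound z (k := 2 * s.re) (by linarith) x
  have h3 : (z.im / ‖w‖ ^ 2) ^ s.re = z.im ^ s.re * ‖w‖ ^ (-(2 * s.re)) := by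
    rw [Real.div_rpow hy.le (by positivity), ← Real.rpow_natCast ‖w‖ 2,
      ← Real.rpow_mul (norm_nonneg _), Real.rpow_neg (norm_nonneg _), div_eq_mul_inv]
    norm_num
  rw [h3]
  gcongr

theorem summable_norm_latticeSummand (k : ℤ) (z : ℍ) {s : ℂ} (hs : 1 < s.re) :
    Summable (fun x ↦ ‖latticeSummand k z s x‖) :=
  Summable.of_nonneg_of_le (fun _ ↦ norm_nonneg _) (norm_latticeSummand_le k z hs)
    (((summable_one_div_norm_rpow (k := 2 * s.re) (by linarith)).mul_left _).mul_left _)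

theorem latticeSummand_gammaSet (k : ℤ) (z : ℍ) {s : ℂ} (hs : 1 < s.re) {n : ℕ}
    (v : gammaSet 1 n 0) : latticeSummand k z s v =
      1 / (n : ℂ) ^ (2 * s) * latticeSummand k z s (divIntMap n v.1) := by
  have h0 : s ≠ 0 := by rintro rfl; norm_num at hs
  rcases eq_or_ne n 0 with rfl | hn
  · have hv := gammaSet_eq_gcd_mul_divIntMap v.2
    rw [zero_smul] at hv
    rw [hv, latticeSummand_zero k z h0]
    simp [h0]
  · conv_lhs => rw [gammaSet_eq_gcd_mul_divIntMap v.2]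
    exact latticeSummand_nsmul k z s hn _

/-- Rows are sorted by their gcd `n`, and homogeneity of degree `-2s` pulls out `n^(-2s)`. The class
`n = 0` is the zero row and contributes `0` on both sides. -/
theorem tsum_latticeSummand_eq_zeta_mul (k : ℤ) (z : ℍ) {s : ℂ} (hs : 1 < s.re) :
    ∑' v : Fin 2 → ℤ, latticeSummand k z s v =
      riemannZeta (2 * s) * ∑' v : gammaSet 1 1 0, latticeSummand k z s v := by
  have h1 : 1 < (2 * s).re := by simp; linarith
  have h0 : 2 * s ≠ 0 := by intro h; rw [h] at h1; norm_num at h1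
  have hsum := summable_norm_latticeSummand k z hs
  have hz : Summable (fun n : ℕ ↦ ‖1 / (n : ℂ) ^ (2 * s)‖) :=
    (Complex.summable_one_div_nat_cpow.2 h1).norm
  simp_rw [← gammaSetDivGcdSigmaEquiv.symm.tsum_eq, gammaSetDivGcdSigmaEquiv_symm_eq]
  rw [Summable.tsum_sigma ?hsumm, zeta_eq_tsum_one_div_nat_cpow h1,
    tsum_mul_tsum_of_summable_norm hz (hsum.subtype _)]
  case hsumm =>
    exact gammaSetDivGcdSigmaEquiv.symm.summable_iff.mpr hsum.of_norm |>.congr <| by simp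
  rw [Summable.tsum_prod' ?h₁ fun b ↦ ?h₂]
  case h₁ =>
    exact summable_mul_of_summable_norm (f := fun (n : ℕ) ↦ 1 / (n : ℂ) ^ (2 * s))
      (g := fun (v : gammaSet 1 1 0) ↦ latticeSummand k z s v) hz (hsum.subtype _)
  case h₂ =>
    exact ((hsum.subtype _).of_norm.mul_left (a := 1 / (b : ℂ) ^ (2 * s)))
  refine tsum_congr fun b ↦ ?_
  rcases eq_or_ne b 0 with rfl | hb
  · simp [latticeSummand_gammaSet k z hs, h0]
  · have : NeZero b := ⟨hb⟩
    simp only [latticeSummand_gammaSet k z hs (n := b), tsum_mul_left]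
    congr 1
    exact (gammaSetDivGcdEquiv b).tsum_eq (fun v ↦ latticeSummand k z s v)

/-- The bottom row of a coset representative, up to sign. -/
def bottomRow (p : Cosets × ℤˣ) : gammaSet 1 1 0 :=
  ⟨fun i ↦ (p.2 : ℤ) * p.1.out 1 i, by
    rw [mem_gammaSet_one]
    have h : IsCoprime (p.1.out 1 0) (p.1.out 1 1) := by
      have := p.1.out.isCoprime_row 1
      exact this
    have hu := p.2.isUnit
    exact (isCoprime_mul_unit_left hu _ _).2 h⟩

theorem mul_inv_mem_gammaInf_iff (g h : SL(2, ℤ)) :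
    h * g⁻¹ ∈ gammaInf ↔ h 1 0 * g 1 1 = h 1 1 * g 1 0 := by
  have e : (h * g⁻¹) 1 0 = h 1 0 * g 1 1 - h 1 1 * g 1 0 := by
    simp [Matrix.SpecialLinearGroup.coe_mul, Matrix.mul_apply, Fin.sum_univ_two,
      Matrix.SpecialLinearGroup.coe_inv, Matrix.adjugate_fin_two]
    ring
  change (h * g⁻¹) 1 0 = 0 ↔ _
  rw [e, sub_eq_zero]

/-- Left multiplication by `±(1 n; 0 1)` changes the bottom row only by the sign, so a coset
together with a sign is the same as a coprime row. -/
theorem bottomRow_bijective : Function.Bijective bottomRow := by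
  constructor
  · rintro ⟨γ, u⟩ ⟨γ', u'⟩ h
    have h' := congrArg Subtype.val h
    have h0 : (u : ℤ) * γ.out 1 0 = u' * γ'.out 1 0 := congrFun h' 0
    have h1 : (u : ℤ) * γ.out 1 1 = u' * γ'.out 1 1 := congrFun h' 1
    have hγ : γ = γ' := by
      rw [← Quotient.out_eq γ, ← Quotient.out_eq γ']
      refine Quotient.sound ?_
      change (QuotientGroup.rightRel gammaInf).r _ _
      rw [QuotientGroup.rightRel_apply, mul_inv_mem_gammaInf_iff]
      have hu := u.ne_zero
      have hu' := u'.ne_zero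
      have : (u : ℤ) * u' * (γ'.out 1 0 * γ.out 1 1 - γ'.out 1 1 * γ.out 1 0) = 0 := by
        linear_combination -(u : ℤ) * γ.out 1 1 * h0 + (u : ℤ) * γ.out 1 0 * h1
      simp only [mul_eq_zero, hu, hu', false_or] at this
      linarith
    subst hγ
    have hd := γ.out.det_coe
    rw [Matrix.det_fin_two] at hd
    -- The determinant `1` of the common representative recovers the sign from the row.
    have : (u : ℤ) = u' := by
      linear_combination (-γ.out 0 1) * h0 + γ.out 0 0 * h1 - ((u : ℤ) - u') * hd
    rw [Units.ext this]
  · rintro ⟨v, hv⟩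
    rw [mem_gammaSet_one] at hv
    obtain ⟨g, -, hg⟩ := ModularGroup.bottom_row_surj hv
    set γ : Cosets := Quotient.mk _ g
    have hrel : g * γ.out⁻¹ ∈ gammaInf := by
      have : (QuotientGroup.rightRel gammaInf).r γ.out g := Quotient.exact (Quotient.out_eq γ)
      rwa [QuotientGroup.rightRel_apply] at this
    obtain ⟨n, hn⟩ := (mem_gammaInf_iff _).1 hrel
    have hrow (i : Fin 2) : v i = (((g * γ.out⁻¹ : SL(2, ℤ)) : Matrix (Fin 2) (Fin 2) ℤ) *
        (γ.out : Matrix (Fin 2) (Fin 2) ℤ)) 1 i := by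
      rw [← Matrix.SpecialLinearGroup.coe_mul, inv_mul_cancel_right]
      exact (congrFun hg i).symm
    rcases hn with hn | hn
    · refine ⟨(γ, 1), Subtype.ext ?_⟩
      funext i
      change _ = v i
      rw [hrow, hn]
      fin_cases i <;> simp [bottomRow, Matrix.mul_apply, Fin.sum_univ_two]
    · refine ⟨(γ, -1), Subtype.ext ?_⟩
      funext i
      change _ = v i
      rw [hrow, hn]
      fin_cases i <;> simp [bottomRow, Matrix.mul_apply, Fin.sum_univ_two]

theorem latticeSummand_bottomRow {k : ℤ} (hk : Even k) (z : ℍ) (s : ℂ) (p : Cosets × ℤˣ) :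
    latticeSummand k z s (bottomRow p) = summand k z s p.1.out := by
  obtain ⟨γ, u⟩ := p
  rw [summand_eq_latticeSummand]
  rcases Int.units_eq_one_or u with rfl | rfl
  · congr 1
    funext i
    simp [bottomRow]
  · rw [← latticeSummand_neg hk]
    congr 1
    funext i
    simp [bottomRow]

theorem tsum_gammaSet_latticeSummand {k : ℤ} (hk : Even k) (z : ℍ) {s : ℂ} (hs : 1 < s.re) :
    ∑' v : gammaSet 1 1 0, latticeSummand k z s v = 2 * eisenstein k z s := by
  set e := Equiv.ofBijective bottomRow bottomRow_bijective
  have hsum : Summable (fun v : gammaSet 1 1 0 ↦ latticeSummand k z s v) :=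
    (summable_norm_latticeSummand k z hs).of_norm.subtype _
  have hsum' : Summable (fun p ↦ latticeSummand k z s (e p)) := e.summable_iff.2 hsum
  rw [← e.tsum_eq, hsum'.tsum_prod, eisenstein, ← tsum_mul_left]
  refine tsum_congr fun γ ↦ ?_
  have (u : ℤˣ) : latticeSummand k z s (e (γ, u)) = summand k z s γ.out :=
    latticeSummand_bottomRow hk z s (γ, u)
  simp only [this]
  rw [tsum_fintype, Finset.sum_const, Finset.card_univ, Fintype.card_units_int]
  simp

/-- The sum over `d` of the lattice summands with given `c`. -/
def rowSum (k : ℤ) (z : ℍ) (s : ℂ) (c : ℤ) : ℂ := ∑' d : ℤ, latticeSummand k z s ![c, d]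

theorem rowSum_zero {k : ℤ} (hk : Even k) (z : ℍ) {s : ℂ} (hs : 1 < s.re) :
    rowSum k z s 0 = 2 * (riemannZeta (2 * s) * (z.im : ℂ) ^ s) := by
  have hy := z.im_pos
  have h1 : 1 < (2 * s).re := by simp; linarith
  have h0 : s ≠ 0 := by rintro rfl; norm_num at hs
  have hsum : Summable (fun d : ℤ ↦ latticeSummand k z s ![0, d]) := by
    refine (summable_norm_latticeSummand k z hs).of_norm.comp_injective (i := fun d : ℤ ↦ ![0, d]) ?_
    intro a b hab
    simpa using congrFun hab 1
  have heven : Function.Even (fun d : ℤ ↦ latticeSummand k z s ![0, d]) := fun d ↦ by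
    change latticeSummand k z s ![0, -d] = latticeSummand k z s ![0, d]
    rw [← latticeSummand_neg hk z s ![0, d]]
    simp
  have hterm (n : ℕ+) : latticeSummand k z s ![0, ((n : ℕ) : ℤ)] =
      1 / ((n : ℕ) : ℂ) ^ (2 * s) * (z.im : ℂ) ^ s := by
    have h := latticeSummand_nsmul k z s n.ne_zero ![0, 1]
    have e : ((n : ℕ) • ![0, 1] : Fin 2 → ℤ) = ![0, ((n : ℕ) : ℤ)] := by
      simp
    rw [e] at h
    rw [h]
    congr 1
    simp [latticeSummand]
  have hz0 : (fun n : ℕ ↦ 1 / (n : ℂ) ^ (2 * s)) 0 = 0 := by simp [h0]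
  rw [rowSum, tsum_int_eq_zero_add_two_mul_tsum_pnat heven hsum]
  simp only [hterm]
  rw [tsum_mul_right, tsum_pnat_eq_tsum_of_eq_zero (f := fun n : ℕ ↦ 1 / (n : ℂ) ^ (2 * s)) hz0,
    ← zeta_eq_tsum_one_div_nat_cpow h1]
  have : (![0, 0] : Fin 2 → ℤ) = 0 := by simp
  rw [this, latticeSummand_zero k z h0]
  simp

theorem zeta_mul_eisenstein {k : ℤ} (hk : Even k) (z : ℍ) {s : ℂ} (hs : 1 < s.re) :
    riemannZeta (2 * s) * eisenstein k z s =
      riemannZeta (2 * s) * (z.im : ℂ) ^ s + ∑' m : ℕ+, rowSum k z s ((m : ℕ) : ℤ) := by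
  have hsum : Summable (fun p : ℤ × ℤ ↦ latticeSummand k z s ![p.1, p.2]) :=
    (finTwoArrowEquiv ℤ).symm.summable_iff.2 (summable_norm_latticeSummand k z hs).of_norm
  have h1 : ∑' v : Fin 2 → ℤ, latticeSummand k z s v = ∑' c : ℤ, rowSum k z s c := by
    rw [← (finTwoArrowEquiv ℤ).symm.tsum_eq]
    exact Summable.tsum_prod hsum
  have hrow : Summable (rowSum k z s) := hsum.prod
  have heven : Function.Even (rowSum k z s) := fun c ↦ by
    rw [rowSum, rowSum, ← (Equiv.neg ℤ).tsum_eq]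
    refine tsum_congr fun d ↦ ?_
    rw [← latticeSummand_neg hk z s ![c, d]]
    simp
  rw [tsum_int_eq_zero_add_two_mul_tsum_pnat heven hrow, rowSum_zero hk z hs,
    tsum_latticeSummand_eq_zeta_mul k z hs, tsum_gammaSet_latticeSummand hk z hs] at h1
  simp only [nsmul_eq_mul, Nat.cast_ofNat] at h1
  linear_combination h1 / 2

/-! ### The phase factor and the expansion for `Re s > 1`. -/

/-- The sign attached to the weight. -/
def weightSign (k : ℤ) : ℝ := if 0 ≤ k then 1 else -1

theorem weightSign_sq (k : ℤ) : weightSign k ^ 2 = 1 := by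
  unfold weightSign
  split_ifs <;> norm_num

/-- For `k ≥ 0` the inverse of the unit `(v + i)/|v + i|` is its conjugate, giving `v - i`; for `k <
0` the exponent is already positive. Evenness of `k` makes the power of `|v + i|` an integral power
of `v² + 1`. -/
theorem unit_zpow_eq {k : ℤ} (hk : Even k) (v : ℝ) :
    (((v : ℂ) + Complex.I) / (‖(v : ℂ) + Complex.I‖ : ℂ)) ^ (-k) =
      ((v : ℂ) - Complex.I * weightSign k) ^ (2 * (k.natAbs / 2)) *
        (((v ^ 2 + 1 : ℝ) : ℂ) ^ (k.natAbs / 2))⁻¹ := by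
  set w := (v : ℂ) + Complex.I
  have hn : ‖w‖ ^ 2 = v ^ 2 + 1 := by
    rw [← Complex.normSq_eq_norm_sq, Complex.normSq_apply]
    simp [w]
    ring
  have hv : 0 < v ^ 2 + 1 := by positivity
  have hw0 : w ≠ 0 := by
    rw [← norm_pos_iff]
    by_contra h
    have : ‖w‖ = 0 := le_antisymm (not_lt.1 h) (norm_nonneg _)
    rw [this] at hn
    nlinarith
  have hnw : (‖w‖ : ℂ) ≠ 0 := by exact_mod_cast (norm_pos_iff.2 hw0).ne'
  have hnc : ((v ^ 2 + 1 : ℝ) : ℂ) = (‖w‖ : ℂ) ^ 2 := by rw [← hn]; push_cast; rfl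
  have hmul : w * ((v : ℂ) - Complex.I) = (‖w‖ : ℂ) ^ 2 := by
    rw [← hnc]
    simp only [w]
    push_cast
    linear_combination -Complex.I_sq
  set κ := k.natAbs / 2
  rw [hnc]
  by_cases h : 0 ≤ k
  · have hkκ : k = ((2 * κ : ℕ) : ℤ) := by
      obtain ⟨m, rfl⟩ := hk
      simp only [κ]
      lia
    have hu : (w / (‖w‖ : ℂ))⁻¹ = ((v : ℂ) - Complex.I) / ‖w‖ := by
      rw [inv_div, div_eq_div_iff hw0 hnw]
      linear_combination -hmul
    rw [weightSign, if_pos h]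
    nth_rewrite 1 [hkκ]
    rw [zpow_neg, zpow_natCast, ← inv_pow, hu, div_pow, ← pow_mul, div_eq_mul_inv]
    simp
  · have hkκ : -k = ((2 * κ : ℕ) : ℤ) := by
      obtain ⟨m, rfl⟩ := hk
      simp only [κ]
      lia
    rw [weightSign, if_neg h, hkκ, zpow_natCast, div_pow, ← pow_mul, div_eq_mul_inv]
    simp [w]

theorem latticeSummand_eq_latticeFun {k : ℤ} (hk : Even k) (z : ℍ) (s : ℂ) (m : ℕ+) (n : ℤ) :
    latticeSummand k z s ![((m : ℕ) : ℤ), n] =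
      (z.im : ℂ) ^ s * ((m * z.im : ℝ) : ℂ) ^ (-(2 * s)) *
        latticeFun (k.natAbs / 2) (weightSign k) s ((m * z.re + n) / (m * z.im)) := by
  have hy := z.im_pos
  have hm : (0 : ℝ) < m := by exact_mod_cast m.pos
  obtain ⟨Y, hY⟩ : ∃ Y : ℝ, Y = m * z.im := ⟨_, rfl⟩
  have hY0 : 0 < Y := by rw [hY]; positivity
  have hYc : (Y : ℂ) ≠ 0 := by exact_mod_cast hY0.ne'
  obtain ⟨v, hv⟩ : ∃ v : ℝ, v = (m * z.re + n) / Y := ⟨_, rfl⟩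
  rw [← hY, ← hv]
  have hvp : 0 < v ^ 2 + 1 := by positivity
  have hvc : ((v ^ 2 + 1 : ℝ) : ℂ) ≠ 0 := by exact_mod_cast hvp.ne'
  have hw : (((m : ℕ) : ℤ) : ℂ) * z + n = (Y : ℂ) * ((v : ℂ) + Complex.I) := by
    have e1 : (Y : ℂ) * v = m * z.re + n := by
      rw [hv]; push_cast; field_simp
    have e2 : (z : ℂ) = z.re + z.im * Complex.I := (Complex.re_add_im (z : ℂ)).symm
    rw [mul_add, e1, e2, hY]
    push_cast
    ring
  have hn : ‖(v : ℂ) + Complex.I‖ ^ 2 = v ^ 2 + 1 := by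
    rw [← Complex.normSq_eq_norm_sq, Complex.normSq_apply]
    simp
    ring
  simp only [latticeSummand, Matrix.cons_val_zero, Matrix.cons_val_one]
  rw [hw, norm_mul, Complex.norm_real, Real.norm_eq_abs, abs_of_pos hY0, Complex.ofReal_mul,
    mul_div_mul_left _ _ hYc, unit_zpow_eq hk, mul_pow, hn, latticeFun]
  have e3 : ((z.im / (Y ^ 2 * (v ^ 2 + 1)) : ℝ) : ℂ) ^ s =
      (z.im : ℂ) ^ s * (Y : ℂ) ^ (-(2 * s)) * ((v ^ 2 + 1 : ℝ) : ℂ) ^ (-s) := by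
    have hq : 0 < z.im / (Y ^ 2 * (v ^ 2 + 1)) := by positivity
    rw [ofReal_cpow_eq_exp hq, ofReal_cpow_eq_exp hy, ofReal_cpow_eq_exp hY0,
      ofReal_cpow_eq_exp hvp, ← Complex.exp_add,
      ← Complex.exp_add, Real.log_div hy.ne' (by positivity),
      Real.log_mul (by positivity) hvp.ne', Real.log_pow]
    congr 1
    push_cast
    ring
  have e4 : ((v ^ 2 + 1 : ℝ) : ℂ) ^ (-(s + (k.natAbs / 2 : ℕ))) =
      ((v ^ 2 + 1 : ℝ) : ℂ) ^ (-s) * (((v ^ 2 + 1 : ℝ) : ℂ) ^ (k.natAbs / 2))⁻¹ := by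
    rw [neg_add, Complex.cpow_add _ _ hvc, Complex.cpow_neg _ ((_ : ℕ) : ℂ), Complex.cpow_natCast]
  rw [e3, e4]
  ring

theorem Gamma_mul_risingProd (k : ℤ) {s : ℂ} (hs : 0 < s.re) :
    Complex.Gamma s * risingProd k s = Complex.Gamma (s + (k.natAbs / 2 : ℕ)) := by
  rw [risingProd]
  induction k.natAbs / 2 with
  | zero => simp
  | succ n ih =>
    have hne : s + n ≠ 0 := by
      intro h
      have := congrArg Complex.re h
      simp at this
      linarith [(Nat.cast_nonneg n : (0 : ℝ) ≤ n)]
    rw [Finset.prod_range_succ, ← mul_assoc, ih]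
    push_cast
    rw [← add_assoc, Complex.Gamma_add_one _ hne]
    ring

/-- The rising product turns `Γ(s)` into `Γ(s + κ)`, so `θ_k(s) = c ζ(2s)` with `c` exactly the
normalisation of the Poisson formula. -/
theorem thetaK_mul_eisenstein {k : ℤ} (hk : Even k) (z : ℍ) {s : ℂ} (hs : 1 < s.re) :
    thetaK k s * eisenstein k z s =
      constantTermAux k z.im s + fourierRemainder (k.natAbs / 2) (weightSign k) z s := by
  set κ := k.natAbs / 2 with hκ
  have hε := weightSign_sq k
  set c := Complex.Gamma (s + κ) * (Real.pi : ℂ) ^ (-s) with hc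
  have h1 := zeta_mul_eisenstein hk z hs
  have h2 : thetaK k s = c * riemannZeta (2 * s) := by
    rw [hc, hκ, ← Gamma_mul_risingProd k (by linarith), thetaK, theta, risingProd]
    ring
  have h3 : thetaK k s = completedRiemannZeta (2 * s) * risingProd k s :=
    thetaK_eq (by rintro rfl; norm_num at hs)
      (Complex.Gammaℝ_ne_zero_of_re_pos (by simp; linarith))
  have hrow (m : ℕ+) : c * rowSum k z s ((m : ℕ) : ℤ) =
      zeroTerm κ z s m + (Real.pi : ℂ) ^ κ * ∑' l : ℤ, fourierTerm κ (weightSign k) z (m, l) s := by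
    rw [← mul_tsum_latticeFun κ hε hs z m, rowSum]
    simp only [latticeSummand_eq_latticeFun hk, tsum_mul_left]
    rfl
  have hsT := summable_fourierTerm κ hε z s
  have hsZ := hasSum_zeroTerm κ z hs
  have h4 : c * ∑' m : ℕ+, rowSum k z s ((m : ℕ) : ℤ) =
      completedRiemannZeta (2 * (1 - s)) * risingProd k (1 - s) * (z.im : ℂ) ^ (1 - s) +
        fourierRemainder κ (weightSign k) z s := by
    rw [← tsum_mul_left, tsum_congr hrow, hsZ.summable.tsum_add (hsT.prod.mul_left _), hsZ.tsum_eq,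
      tsum_mul_left, fourierRemainder, hsT.tsum_prod]
    rfl
  rw [constantTermAux, add_assoc, ← h4, ← h3, h2]
  linear_combination c * h1

end WeightEisenstein

end

open WeightEisenstein in
theorem corollary3p3 (k : ℤ) (hk : Even k) :
    (∀ z : UpperHalfPlane, IsCompletedEisenstein k z (completedEisenstein k z)) ∧
    ∃ R : UpperHalfPlane → ℂ → ℂ,
      (∀ z : UpperHalfPlane, Differentiable ℂ (R z)) ∧
      (∀ (z : UpperHalfPlane) (s : ℂ), (k = 0 → s ≠ 0 ∧ s ≠ 1) →
        completedEisenstein k z s = constantTerm k z.im s + R z s) ∧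
      ∀ σ : ℝ, ∃ C : ℝ, ∀ (z : UpperHalfPlane) (s : ℂ), s.re = σ →
        ‖R z s‖ ≤ C * ((z.im ^ (|(k : ℝ)| / 2 + 1 / 2)
          + z.im ^ (-|σ - 1 / 2| - |(k : ℝ)| / 2 - 3 / 2)) * Real.exp (-2 * Real.pi * z.im)) := by
  have hε := weightSign_sq k
  have key (z : UpperHalfPlane) := completedEisenstein_of_expansion hk z
    (differentiable_fourierRemainder (k.natAbs / 2) hε z) fun s hs ↦ thetaK_mul_eisenstein hk z hs
  -- Evenness of `k` makes the truncated division exact.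
  have hκ : (((k.natAbs / 2 : ℕ) : ℝ)) = |(k : ℝ)| / 2 := by
    have h2 : 2 * (k.natAbs / 2) = k.natAbs := by
      obtain ⟨m, rfl⟩ := hk
      lia
    have h3 : ((2 * (k.natAbs / 2) : ℕ) : ℝ) = |(k : ℝ)| := by
      rw [h2, Nat.cast_natAbs, Int.cast_abs]
    rw [← h3]
    push_cast
    ring
  refine ⟨fun z ↦ (key z).1, fourierRemainder (k.natAbs / 2) (weightSign k),
    fun z ↦ differentiable_fourierRemainder _ hε z, fun z ↦ (key z).2, fun σ ↦ ?_⟩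
  obtain ⟨C, hC⟩ := exists_norm_fourierRemainder_le (k.natAbs / 2) hε σ
  rw [hκ] at hC
  exact ⟨C, hC⟩
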